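/- **Setting.** Let $G$ be a continuum (a nonempty compact connected metric space). The order of $x\in G$ is the least cardinal $\kappa$ such that $x$ has arbitrarily small open neighbourhoods whose boundary has at most $\kappa$ points. Assume that $G$ is a *tame graph*: the set of points of order $1$ or of order at least $3$ has countable closure. For an arc $\alpha\subset G$ let $\alpha^\circ$ be $\alpha$ without its two endpoints; $\alpha$ is *free* if $\alpha^\circ$ is open in $G$. A *countable Markov partition* for $f\colon G\to G$ is a countable family $\mathcal P$ of free arcs with pairwise disjoint interiors $i^\circ$, covering $G$ up to a countable set, such that for all $i,j\in\mathcal P$ the map $f$ sends $i$ homeomorphically onto $f(i)$, and $f(i)\cap j^\circ\neq\emptyset$ implies $f(i)\supset j$. Let $f\colon G\to G$ be continuous and topologically mixing (for all nonempty open $U,V$ there is $n$ with $f^m(U)\cap V\ne\emptyset$ for all $m\ge n$), and suppose that $f$ admits a countably infinite Markov partition. Let $\mathcal P$ be a countable Markov partition for $f$, and put $m_{ij}=1$ if $f(i)\supset j$ and $m_{ij}=0$ otherwise, $i,j\in\mathcal P$. Let $\lambda>1$ and let $v=(v_i)_{i\in\mathcal P}$ be a nonzero nonnegative vector with $\sum_{j}m_{ij}v_j\le\lambda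 v_i$ for every $i\in\mathcal P$ and $\sum_i v_i=1$. Put $\lambda_i=\frac1{v_i}\sum_j m_{ij}v_j$ (all $v_i$ are in fact positive), and assume that $\lambda_i<\lambda$ for only finitely many $i$. Let $P=G\setminus\bigcup_{i\in\mathcal P}i^\circ$, and for $n\ge0$ let $\mathcal P_n$ be the set of closures of the connected components of $G\setminus f^{-n}(P)$; its elements are arcs of the form $[i_0\cdots i_n]=i_0\cap f^{-1}(i_1)\cap\dots\cap f^{-n}(i_n)$ with $i_0,\dots,i_n\in\mathcal P$. For $[i_0\cdots i_n]\in\mathcal P_n$ put $\Delta([i_0\cdots i_n])=v_{i_n}/\prod_{\ell=0}^{n-1}\lambda_{i_\ell}$. Let $\mathcal A(G)$ be the set of all points (viewed as one-point sets) and all arcs of $G$, and for distinct $x,y\in G$ let $\mathcal A_{xy}$ be the set of arcs in $G$ with endpoints $x,y$. For $\gamma\in\mathcal A(G)$ define $$A_n(\gamma)=\sum_{\gamma\supset[i_0\cdots i_n]\in\mathcal P_n}\Delta([i_0\cdots i_n]),\qquad A(\gamma)=\sup_{n}A_n(\gamma).$$ **Proposition.** The maps $A_n$, $A$ take values in $[0,\infty)$,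 and: 1. For every $\gamma\in\mathcal A(G)$ and every $n$, $A_n(\gamma)\le A_{n+1}(\gamma)$; hence $A(\gamma)=\lim_{n\to\infty}A_n(\gamma)$. 2. If $\gamma\in\mathcal A(G)$ is not a point, then $A(\gamma)>0$. 3. $A$ is additive: if $\gamma\in\mathcal A(G)$, $t\in\gamma$, and $\gamma_1,\gamma_2\in\mathcal A(G)$ satisfy $\gamma=\gamma_1\cup\gamma_2$ and $\gamma_1\cap\gamma_2=\{t\}$, then $A(\gamma)=A(\gamma_1)+A(\gamma_2)$. 4. If $(\gamma^m)_m$ is a sequence in $\mathcal A(G)$ with $\gamma^m\supset\gamma^{m+1}$ for all $m$ and $\bigcap_m\gamma^m=\{x\}$ for some $x\in G$, then $\lim_{m}A(\gamma^m)=0$. 5. For all distinct $x,y\in G$ there is an arc $\alpha\in\mathcal A_{xy}$ with $A(\alpha)=\inf\{A(\beta):\beta\in\mathcal A_{xy}\}$. -/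

import Mathlib

open Set Filter Topology
open scoped ENNReal

namespace TameGraph

universe u

noncomputable section

variable {G : Type u} [TopologicalSpace G]

/-! ### Arcs -/

/-- `γ` is an arc with endpoints `x` and `y`: the image of `[0,1]` under a continuous injection
(a homeomorphism onto its image when `G` is Hausdorff) sending `0` to `x` and `1` to `y`. -/
def IsArcBetween (x y : G) (γ : Set G) : Prop :=
  ∃ h : unitInterval → G,
    Continuous h ∧ Function.Injective h ∧ range h = γ ∧ h 0 = x ∧ h 1 = y

/-- `γ` is an arc. -/
def IsArc (γ : Set G) : Prop := ∃ x y, IsArcBetween x y γ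

/-- The set of the endpoints of an arc. -/
def arcEnds (γ : Set G) : Set G := {x | ∃ y, IsArcBetween x y γ}

/-- The arc without its endpoints. -/
def arcInterior (γ : Set G) : Set G := γ \ arcEnds γ

/-- A free arc: an arc that is open in the space once its endpoints are removed. -/
def IsFreeArc (γ : Set G) : Prop := IsArc γ ∧ IsOpen (arcInterior γ)

/-- The set of all points (as singletons) and all arcs of `G`. -/
def pointsAndArcs (G : Type u) [TopologicalSpace G] : Set (Set G) :=
  {γ | (∃ x, γ = {x}) ∨ IsArc γ}

/-- The set of all arcs with endpoints `x` and `y`. -/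
def arcsBetween (x y : G) : Set (Set G) := {γ | IsArcBetween x y γ}

/-! ### Tame graphs -/

/-- The (Menger–Urysohn) order of a point: the least cardinal `κ` such that `x` has arbitrarily
small open neighbourhoods whose boundary has at most `κ` points. -/
def pointOrder (x : G) : Cardinal.{u} :=
  sInf {κ | ∀ U : Set G, IsOpen U → x ∈ U →
    ∃ V : Set G, IsOpen V ∧ x ∈ V ∧ V ⊆ U ∧ Cardinal.mk (frontier V) ≤ κ}

/-- The points of order one. -/
def endpoints (G : Type u) [TopologicalSpace G] : Set G := {x | pointOrder x = 1}

/-- The points of order at least three. -/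
def branchpoints (G : Type u) [TopologicalSpace G] : Set G := {x | 3 ≤ pointOrder x}

/-- The defining condition of a tame graph, for a continuum `G`. -/
def IsTameGraph (G : Type u) [TopologicalSpace G] : Prop :=
  (closure (endpoints G ∪ branchpoints G)).Countable

/-- A tame partition: a countable family of free arcs with pairwise disjoint interiors covering
`G` up to a countable set. -/
structure IsTamePartition (P : Set (Set G)) : Prop where
  countable : P.Countable
  freeArc : ∀ i ∈ P, IsFreeArc i
  disjoint : ∀ i ∈ P, ∀ j ∈ P, i ≠ j → Disjoint (arcInterior i) (arcInterior j)
  cover : (⋃₀ P)ᶜ.Countable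

/-! ### Countably Markov and mixing maps -/

/-- A countable Markov partition for `f`. -/
structure IsMarkovPartition (f : G → G) (P : Set (Set G)) : Prop where
  tame : IsTamePartition P
  monotone : ∀ i ∈ P, IsEmbedding fun x : i => f x
  markov : ∀ i ∈ P, ∀ j ∈ P, (f '' i ∩ arcInterior j).Nonempty → j ⊆ f '' i

/-- Topological mixing. -/
def IsTopMixing (f : G → G) : Prop :=
  ∀ U V : Set G, IsOpen U → IsOpen V → U.Nonempty → V.Nonempty →
    ∃ n : ℕ, ∀ m ≥ n, (f^[m] '' U ∩ V).Nonempty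

/-- The class of continuous, countably Markov and mixing maps. -/
structure IsCPM (f : G → G) : Prop where
  continuous : Continuous f
  exists_partition : ∃ P : Set (Set G), IsMarkovPartition f P ∧ P.Infinite
  mixing : IsTopMixing f

open Classical in
/-- The transition matrix of `f` with respect to `P`. -/
def transition (f : G → G) (P : Set (Set G)) (i j : P) : ℝ :=
  if (j : Set G) ⊆ f '' (i : Set G) then 1 else 0

/-- `v` is a `lam`-subeigenvector of the transition matrix: nonzero, nonnegative, and
`M v ≤ lam v` coordinatewise (with convergent row sums). -/
structure IsSubeigenvector (f : G → G) (P : Set (Set G)) (lam : ℝ) (v : P → ℝ) : Prop where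
  nonneg : ∀ i, 0 ≤ v i
  ne_zero : v ≠ 0
  summable : ∀ i, Summable fun j => transition f P i j * v j
  le : ∀ i, ∑' j, transition f P i j * v j ≤ lam * v i

/-- The local expansion rate `(M v)_i / v_i`. -/
def rate (f : G → G) (P : Set (Set G)) (v : P → ℝ) (i : P) : ℝ :=
  (∑' j, transition f P i j * v j) / v i

/-! ### Refined partitions and the arc maps -/

/-- The set of partition points: the complement of the interiors of the partition arcs. -/
def partitionPoints (P : Set (Set G)) : Set G := (⋃ i ∈ P, arcInterior i)ᶜ

/-- The `n`-th refined partition: the closures of the connected components of the complement of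
`f⁻ⁿ(partitionPoints P)`. -/
def refinement (f : G → G) (P : Set (Set G)) (n : ℕ) : Set (Set G) :=
  {α | ∃ x ∈ (f^[n] ⁻¹' partitionPoints P)ᶜ,
    α = closure (connectedComponentIn (f^[n] ⁻¹' partitionPoints P)ᶜ x)}

/-- The set `[i₀ i₁ ⋯ iₙ] = i₀ ∩ f⁻¹ i₁ ∩ ⋯ ∩ f⁻ⁿ iₙ` of a word `i₀ i₁ ⋯ iₙ` over `P`. -/
def cylinder (f : G → G) {P : Set (Set G)} {n : ℕ} (w : Fin (n + 1) → P) : Set G :=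
  ⋂ k : Fin (n + 1), f^[(k : ℕ)] ⁻¹' (w k : Set G)

/-- The weight `v_{iₙ} / (rate i₀ ⋯ rate iₙ₋₁)` of a word `i₀ i₁ ⋯ iₙ`. -/
def weight (f : G → G) (P : Set (Set G)) (v : P → ℝ) {n : ℕ} (w : Fin (n + 1) → P) : ℝ :=
  v (w (Fin.last n)) / ∏ k : Fin n, rate f P v (w k.castSucc)

/-- The arc map `A_n`: the total weight of the arcs `[i₀ ⋯ iₙ]` of the `n`-th refined partition
that are contained in `γ`. -/
def arcMapN (f : G → G) (P : Set (Set G)) (v : P → ℝ) (n : ℕ) (γ : Set G) : ℝ≥0∞ :=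
  ∑' w : {w : Fin (n + 1) → P // cylinder f w ∈ refinement f P n ∧ cylinder f w ⊆ γ},
    ENNReal.ofReal (weight f P v w.1)

/-- The arc map `A`, the supremum of the arc maps `A_n`. -/
def arcMap (f : G → G) (P : Set (Set G)) (v : P → ℝ) (γ : Set G) : ℝ≥0∞ :=
  ⨆ n : ℕ, arcMapN f P v n γ

end

end TameGraph

/-!
Code the points of `G` by their itineraries through the partition arcs. With
`p i j = m i j * v j / (λ i * v i)`, which is a stochastic matrix, and the initial distribution `v`,
the weight `Δ([i₀ ⋯ iₙ])` is the probability that the Markov chain starts with the word `i₀ ⋯ iₙ`.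
Thus `A_n(γ)` is the probability that the first `n + 1` symbols determine a cylinder inside `γ`;
these events increase with `n`, and `A(γ)` is the probability of their union.

A single itinerary has probability zero: either it returns infinitely often to one arc, and then by
mixing it passes infinitely often through a state with at least two possible successors, or it
eventually stays in the arcs with `λ i = λ > 1`, so that its weights decay geometrically. A point
lies on countably many itineraries, hence carries no mass; additivity and continuity follow.

For the minimal arc, take arcs `β k` from `x` to `y` whose values `A(β k)` tend to the infimum, with
each cylinder contained in almost all or in almost none of them. Their upper limit is a continuum
containing `x` and `y`. Partition arcs shrink to points and cover all but countably many points, so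
such a continuum contains an arc from `x` to `y`: summing suitable functions, each of which moves on
one partition arc only, gives a function that is injective on a minimal subcontinuum joining `x` to
`y`. A cylinder in this arc that misses `x` and `y` lies in almost all `β k`, whence
`A(α) ≤ lim A(β k)`.
-/

namespace TameGraph

section MarkovMeasure

open MeasureTheory ProbabilityTheory

variable {ι : Type*} [Countable ι] [MeasurableSpace ι] [MeasurableSingletonClass ι]

/-- The Markov kernel that draws the next state of a chain from its current state. -/
noncomputable def transitionKernel (q : ι → PMF ι) (n : ℕ) :
    Kernel (Π _ : Finset.Iic n, ι) ι :=
  (Kernel.ofFunOfCountable fun i => (q i).toMeasure).comap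
    (fun u => u ⟨n, Finset.mem_Iic.2 le_rfl⟩) (measurable_pi_apply _)

instance (q : ι → PMF ι) (n : ℕ) : IsMarkovKernel (transitionKernel q n) :=
  ⟨fun _ => PMF.toMeasure.isProbabilityMeasure _⟩

/-- The law of the Markov chain with initial distribution `q₀` and transition probabilities `q`. -/
noncomputable def markovMeasure (q₀ : PMF ι) (q : ι → PMF ι) : Measure (ℕ → ι) :=
  Kernel.trajMeasure (X := fun _ => ι) q₀.toMeasure (transitionKernel q)

instance (q₀ : PMF ι) (q : ι → PMF ι) : IsProbabilityMeasure (markovMeasure q₀ q) := by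
  unfold markovMeasure
  infer_instance

theorem markovMeasure_setOf_apply_zero_eq (q₀ : PMF ι) (q : ι → PMF ι) (i : ι) :
    markovMeasure q₀ q {ω | ω 0 = i} = q₀ i := by
  have hmap : (markovMeasure q₀ q).map (Preorder.frestrictLe 0) =
      q₀.toMeasure.map (MeasurableEquiv.piUnique (fun _ : Finset.Iic 0 => ι)).symm := by
    rw [markovMeasure, Kernel.trajMeasure, Measure.map_comp _ _ (by fun_prop),
      Kernel.traj_map_frestrictLe, Kernel.partialTraj_self, Measure.id_comp]
  have hpre : {ω : ℕ → ι | ω 0 = i} =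
      Preorder.frestrictLe (π := fun _ => ι) 0 ⁻¹' {u | u ⟨0, by simp⟩ = i} := by
    ext ω; simp
  have hmeas : MeasurableSet {u : Π _ : Finset.Iic 0, ι | u ⟨0, by simp⟩ = i} :=
    measurable_pi_apply (X := fun _ : Finset.Iic 0 => ι) _ (measurableSet_singleton i)
  have hsymm : (MeasurableEquiv.piUnique (fun _ : Finset.Iic 0 => ι)).symm ⁻¹'
      {u | u ⟨0, by simp⟩ = i} = {i} := by
    ext j; simp
  rw [hpre, ← Measure.map_apply (by fun_prop) hmeas, hmap, Measure.map_apply (by fun_prop) hmeas,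
    hsymm, PMF.toMeasure_apply_singleton _ _ (measurableSet_singleton _)]

theorem markovMeasure_setOf_forall_le_succ_eq (q₀ : PMF ι) (q : ι → PMF ι) (n : ℕ)
    (w : ℕ → ι) :
    markovMeasure q₀ q {ω | ∀ k ≤ n + 1, ω k = w k} =
      markovMeasure q₀ q {ω | ∀ k ≤ n, ω k = w k} * q (w n) (w (n + 1)) := by
  have hpast : MeasurableSet ({Preorder.frestrictLe (π := fun _ => ι) n w} : Set _) :=
    measurableSet_singleton _
  have hnext : MeasurableSet ({w (n + 1)} : Set ι) := measurableSet_singleton _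
  have hpre_succ : {ω : ℕ → ι | ∀ k ≤ n + 1, ω k = w k} =
      (fun ω : ℕ → ι => (Preorder.frestrictLe (π := fun _ => ι) n ω, ω (n + 1))) ⁻¹'
        ({Preorder.frestrictLe (π := fun _ => ι) n w} ×ˢ {w (n + 1)}) := by
    ext ω
    simp [funext_iff, Nat.le_succ_iff, or_imp, forall_and]
  have hpre : {ω : ℕ → ι | ∀ k ≤ n, ω k = w k} =
      Preorder.frestrictLe (π := fun _ => ι) n ⁻¹'
        {Preorder.frestrictLe (π := fun _ => ι) n w} := by
    ext ω; simp [funext_iff]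
  rw [hpre_succ, hpre, ← Measure.map_apply (by fun_prop) (hpast.prod hnext),
    ← Measure.map_apply (by fun_prop) hpast, markovMeasure,
    ← Kernel.map_frestrictLe_trajMeasure_compProd_eq_map_trajMeasure,
    Measure.compProd_apply_prod hpast hnext, Measure.restrict_singleton,
    lintegral_smul_measure, lintegral_dirac, smul_eq_mul]
  congr 1
  exact PMF.toMeasure_apply_singleton _ _ hnext

theorem markovMeasure_setOf_forall_le_eq (q₀ : PMF ι) (q : ι → PMF ι) (n : ℕ) (w : ℕ → ι) :
    markovMeasure q₀ q {ω | ∀ k ≤ n, ω k = w k} =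
      q₀ (w 0) * ∏ k ∈ Finset.range n, q (w k) (w (k + 1)) := by
  induction n with
  | zero => simpa using markovMeasure_setOf_apply_zero_eq q₀ q (w 0)
  | succ n ih => rw [markovMeasure_setOf_forall_le_succ_eq, ih, Finset.prod_range_succ, mul_assoc]

end MarkovMeasure

section Arcs

variable {G : Type*} [TopologicalSpace G]

theorem exists_continuous_lift {X Y Z : Type*} [TopologicalSpace X] [TopologicalSpace Y]
    [TopologicalSpace Z] [CompactSpace X] [T2Space Y] {h : X → Y} (hc : Continuous h)
    (hi : Function.Injective h) {k : Z → Y} (kc : Continuous k) (hk : range k ⊆ range h) :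
    ∃ ψ : Z → X, Continuous ψ ∧ ∀ z, h (ψ z) = k z := by
  choose ψ hψ using fun z => hk (mem_range_self z)
  refine ⟨ψ, (hc.isClosedEmbedding hi).isEmbedding.continuous_iff.2 ?_, hψ⟩
  rwa [show h ∘ ψ = k from funext hψ]

theorem IsArcBetween.symm {x y : G} {γ : Set G} (hγ : IsArcBetween x y γ) :
    IsArcBetween y x γ := by
  obtain ⟨h, hc, hi, hr, h0, h1⟩ := hγ
  refine ⟨h ∘ unitInterval.symm, hc.comp unitInterval.continuous_symm,
    hi.comp unitInterval.symm_bijective.injective, ?_, by simpa, by simpa⟩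
  rw [unitInterval.symm_bijective.surjective.range_comp, hr]

theorem image_Ioo_nonempty {X : Type*} (g : unitInterval → X) : (g '' Ioo 0 1).Nonempty :=
  (nonempty_Ioo.2 zero_lt_one).image g

theorem image_Ioo_eq_range_diff {X : Type*} {h : unitInterval → X} (hi : Function.Injective h) :
    h '' Ioo 0 1 = range h \ {h 0, h 1} := by
  rw [← image_univ, ← image_pair, ← image_sdiff hi]
  congr 1
  ext s
  simp only [mem_Ioo, unitInterval.pos_iff_ne_zero, unitInterval.lt_one_iff_ne_one,
    Set.mem_sdiff, mem_univ, true_and, mem_insert_iff, mem_singleton_iff, not_or]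

theorem isPreconnected_image_Ioo {h : unitInterval → G} (hc : Continuous h) :
    IsPreconnected (h '' Ioo 0 1) :=
  isPreconnected_Ioo.image _ hc.continuousOn

variable [T2Space G] {h g : unitInterval → G}

theorem image_Ioo_subset_of_range_subset (hc : Continuous h) (hi : Function.Injective h)
    (gc : Continuous g) (gi : Function.Injective g) (hgh : range g ⊆ range h) :
    g '' Ioo 0 1 ⊆ h '' Ioo 0 1 := by
  obtain ⟨ψ, ψc, hψ⟩ := exists_continuous_lift hc hi gc hgh
  have ψi : Function.Injective ψ := fun a b hab => gi (by rw [← hψ, ← hψ, hab])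
  rintro _ ⟨s, ⟨hs0, hs1⟩, rfl⟩
  refine ⟨ψ s, ?_, hψ s⟩
  rcases ψc.strictMono_of_inj_boundedOrder' ψi with hm | hm
  · exact ⟨unitInterval.nonneg'.trans_lt (hm hs0), (hm hs1).trans_le unitInterval.le_one'⟩
  · exact ⟨unitInterval.nonneg'.trans_lt (hm hs1), (hm hs0).trans_le unitInterval.le_one'⟩

theorem arcEnds_range (hc : Continuous h) (hi : Function.Injective h) :
    arcEnds (range h) = {h 0, h 1} := by
  apply Subset.antisymm
  · rintro _ ⟨_, g, gc, gi, hr, rfl, -⟩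
    by_contra hn
    have hg0 : g 0 ∈ h '' Ioo 0 1 := by
      rw [image_Ioo_eq_range_diff hi]; exact ⟨hr ▸ mem_range_self 0, hn⟩
    obtain ⟨s, hs, hs'⟩ := image_Ioo_subset_of_range_subset gc gi hc hi hr.symm.subset hg0
    exact hs.1.ne' (gi hs')
  · have hA : IsArcBetween (h 0) (h 1) (range h) := ⟨h, hc, hi, rfl, rfl, rfl⟩
    rintro _ (rfl | rfl)
    exacts [⟨_, hA⟩, ⟨_, hA.symm⟩]

theorem arcInterior_range (hc : Continuous h) (hi : Function.Injective h) :
    arcInterior (range h) = h '' Ioo 0 1 := by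
  rw [arcInterior, arcEnds_range hc hi, image_Ioo_eq_range_diff hi]

theorem closure_image_Ioo (hc : Continuous h) : closure (h '' Ioo 0 1) = range h := by
  rw [← image_closure_of_isCompact isClosed_closure.isCompact hc.continuousOn,
    closure_Ioo zero_ne_one, ← image_univ]
  congr 1
  exact Icc_bot_top

theorem IsFreeArc.exists_param {i : Set G} (hi : IsFreeArc i) :
    ∃ h : unitInterval → G, Continuous h ∧ Function.Injective h ∧ range h = i ∧
      arcInterior i = h '' Ioo 0 1 ∧ IsOpen (h '' Ioo 0 1) := by
  obtain ⟨⟨_, _, h, hc, hinj, rfl, -, -⟩, ho⟩ := hi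
  have hint := arcInterior_range hc hinj
  exact ⟨h, hc, hinj, rfl, hint, hint ▸ ho⟩

theorem isOpen_image_of_subset_Ioo (hc : Continuous h) (hi : Function.Injective h)
    (ho : IsOpen (h '' Ioo 0 1)) {O : Set unitInterval} (hO : IsOpen O) (hs : O ⊆ Ioo 0 1) :
    IsOpen (h '' O) := by
  have hdiff : h '' O = h '' Ioo 0 1 ∩ (h '' Oᶜ)ᶜ := by
    rw [← sdiff_eq, ← image_sdiff hi, sdiff_compl, inter_eq_right.2 hs]
  rw [hdiff]
  exact ho.inter (hO.isClosed_compl.isCompact.image hc).isClosed.isOpen_compl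

theorem mem_interior_image_Icc (hc : Continuous h) (hi : Function.Injective h)
    (ho : IsOpen (h '' Ioo 0 1)) (gc : Continuous g) (gi : Function.Injective g)
    {a b t : unitInterval} (hat : a < t) (htb : t < b)
    (hab : ∀ s ∈ Icc a b, g s ∈ h '' Ioo 0 1) : g t ∈ interior (g '' Icc a b) := by
  have : Fact (a ≤ b) := ⟨(hat.trans htb).le⟩
  obtain ⟨ψ, ψc, hψ⟩ := exists_continuous_lift hc hi
    (gc.comp (continuous_subtype_val (p := (· ∈ Icc a b)))) <| by
      rintro _ ⟨s, rfl⟩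
      exact image_subset_range h _ (hab s s.2)
  have ψi : Function.Injective ψ := fun p q hpq =>
    Subtype.val_injective (gi ((hψ p).symm.trans (hpq ▸ hψ q)))
  have hψ_mem : ∀ s, ψ s ∈ Ioo 0 1 := fun s => by
    obtain ⟨r, hr, hr'⟩ := hab s s.2
    rwa [← hi (hr'.trans (hψ s).symm)]
  let T : Icc a b := ⟨t, hat.le, htb.le⟩
  have mem_of_lt_of_lt : ∀ p q, ψ p < ψ T → ψ T < ψ q → g t ∈ interior (g '' Icc a b) := by
    intro p q hp hq
    refine mem_interior.2 ⟨h '' Ioo (ψ p) (ψ q), ?_, isOpen_image_of_subset_Ioo hc hi ho isOpen_Ioo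
      (Ioo_subset_Ioo (hψ_mem p).1.le (hψ_mem q).2.le), ψ T, ⟨hp, hq⟩, hψ T⟩
    rintro _ ⟨s, hs, rfl⟩
    obtain ⟨r, rfl⟩ := mem_range_of_exists_le_of_exists_ge ψc ⟨p, hs.1.le⟩ ⟨q, hs.2.le⟩
    exact ⟨r, r.2, (hψ r).symm⟩
  rcases ψc.strictMono_of_inj_boundedOrder' ψi with hm | hm
  · exact mem_of_lt_of_lt ⊥ ⊤ (hm hat) (hm htb)
  · exact mem_of_lt_of_lt ⊤ ⊥ (hm htb) (hm hat)

theorem mem_interior_range (hc : Continuous h) (hi : Function.Injective h)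
    (ho : IsOpen (h '' Ioo 0 1)) (gc : Continuous g) (gi : Function.Injective g)
    {t : unitInterval} (ht : t ∈ Ioo 0 1) (hgt : g t ∈ h '' Ioo 0 1) :
    g t ∈ interior (range g) := by
  obtain ⟨l, u, ⟨hl, hu⟩, hlu⟩ := (mem_nhds_iff_exists_Ioo_subset' ⟨0, ht.1⟩ ⟨1, ht.2⟩).1
    ((ho.preimage gc).mem_nhds hgt)
  obtain ⟨a, hla, hat⟩ := exists_between hl
  obtain ⟨b, htb, hbu⟩ := exists_between hu
  exact interior_mono (image_subset_range g _) <| mem_interior_image_Icc hc hi ho gc gi hat htb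
    fun s hs => hlu ⟨hla.trans_le hs.1, hs.2.trans_lt hbu⟩

theorem image_Ioo_subset_range_of_inter_nonempty (hc : Continuous h) (hi : Function.Injective h)
    (ho : IsOpen (h '' Ioo 0 1)) (gc : Continuous g) (gi : Function.Injective g)
    (h0 : g 0 ∉ h '' Ioo 0 1) (h1 : g 1 ∉ h '' Ioo 0 1)
    (hne : (range g ∩ h '' Ioo 0 1).Nonempty) : h '' Ioo 0 1 ⊆ range g := by
  have inter_subset_interior : range g ∩ h '' Ioo 0 1 ⊆ interior (range g) := by
    rintro _ ⟨⟨t, rfl⟩, ht⟩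
    refine mem_interior_range hc hi ho gc gi ⟨?_, ?_⟩ ht
    · exact unitInterval.pos_iff_ne_zero.2 (by rintro rfl; exact h0 ht)
    · exact unitInterval.lt_one_iff_ne_one.2 (by rintro rfl; exact h1 ht)
  have hcover : h '' Ioo 0 1 ⊆ interior (range g) ∪ (range g)ᶜ := fun z hz =>
    (em (z ∈ range g)).imp_left fun hzg => inter_subset_interior ⟨hzg, hz⟩
  have hdisj : Disjoint (interior (range g)) (range g)ᶜ :=
    disjoint_compl_right.mono_left interior_subset
  obtain ⟨p, hpg, hp⟩ := hne
  exact ((isPreconnected_image_Ioo hc).subset_left_of_subset_union isOpen_interior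
    (isCompact_range gc).isClosed.isOpen_compl hdisj hcover
    ⟨p, hp, inter_subset_interior ⟨hpg, hp⟩⟩).trans interior_subset

end Arcs

section CountableSets

theorem not_countable_Ioo_unitInterval {a b : unitInterval} (hab : a < b) :
    ¬ (Ioo a b).Countable := by
  intro hcount
  obtain ⟨c, hac, hcb⟩ := exists_between hab
  obtain ⟨d, had, hdc⟩ := exists_between hac
  exact hdc.ne (hcount.isTotallyDisconnected _ Subset.rfl isPreconnected_Ioo
    ⟨had, hdc.trans hcb⟩ ⟨hac, hcb⟩)

theorem dense_compl_of_countable {X : Type*} [TopologicalSpace X] [T1Space X] [BaireSpace X]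
    [ConnectedSpace X] [Nontrivial X] {Q : Set X} (hQ : Q.Countable) : Dense Qᶜ := by
  rw [← biUnion_of_singleton Q, compl_iUnion₂]
  exact dense_biInter_of_isOpen (fun _ _ => isOpen_compl_singleton) hQ
    fun x _ => dense_compl_singleton x

end CountableSets

section Continua

variable {X : Type*} [TopologicalSpace X]

theorem isPreconnected_iInter_of_directed [T2Space X] {ι : Type*} [Nonempty ι] {K : ι → Set X}
    (hd : Directed (· ⊇ ·) K) (hc : ∀ i, IsCompact (K i)) (hK : ∀ i, IsPreconnected (K i)) :
    IsPreconnected (⋂ i, K i) := by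
  have hclosed : IsClosed (⋂ i, K i) := isClosed_iInter fun i => (hc i).isClosed
  have hcompact : IsCompact (⋂ i, K i) :=
    (hc (Classical.arbitrary ι)).of_isClosed_subset hclosed (iInter_subset _ _)
  rw [isPreconnected_iff_subset_of_fully_disjoint_closed hclosed]
  intro A B hA hB hcover hAB
  obtain ⟨U, V, hU, hV, hAU, hBV, hUV⟩ := SeparatedNhds.of_isCompact_isCompact
    (hcompact.inter_right hA) (hcompact.inter_right hB)
    (hAB.mono inter_subset_right inter_subset_right)
  obtain ⟨i, hi⟩ := exists_subset_nhds_of_isCompact hd hc (U := U ∪ V) fun z hz =>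
    (hU.union hV).mem_nhds <|
      (hcover hz).imp (fun hzA => hAU ⟨hz, hzA⟩) fun hzB => hBV ⟨hz, hzB⟩
  rcases (isPreconnected_iff_subset_of_disjoint.1 (hK i)) U V hU hV hi
    (by rw [hUV.inter_eq, inter_empty]) with hKU | hKV
  · exact Or.inl fun z hz => (hcover hz).resolve_right fun hzB =>
      disjoint_left.1 hUV (hKU (mem_iInter.1 hz i)) (hBV ⟨hz, hzB⟩)
  · exact Or.inr fun z hz => (hcover hz).resolve_left fun hzA =>
      disjoint_left.1 hUV (hAU ⟨hz, hzA⟩) (hKV (mem_iInter.1 hz i))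

theorem subset_left_of_isPreconnected_of_isClosed {M A B : Set X} (hM : IsPreconnected M)
    (hA : IsClosed A) (hB : IsClosed B) (hcover : M ⊆ A ∪ B) (hAB : ∀ z ∈ M, z ∈ A → z ∉ B)
    (hMA : (M ∩ A).Nonempty) : M ⊆ A := by
  refine (isPreconnected_iff_subset_of_disjoint_closed.1 hM A B hA hB hcover ?_).resolve_right ?_
  · exact eq_empty_of_forall_notMem fun z ⟨hz, hzA, hzB⟩ => hAB z hz hzA hzB
  · obtain ⟨p, hp, hpA⟩ := hMA
    exact fun hMB => hAB p hp hpA (hMB hp)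

/-- `M` is a continuum irreducible between `x` and `y`: no proper subcontinuum of `M` contains
both points. -/
structure IsIrreducibleBetween (x y : X) (M : Set X) : Prop where
  isCompact : IsCompact M
  isPreconnected : IsPreconnected M
  left_mem : x ∈ M
  right_mem : y ∈ M
  minimal : ∀ K ⊆ M, IsCompact K → IsPreconnected K → x ∈ K → y ∈ K → M ⊆ K

theorem exists_isIrreducibleBetween [T2Space X] {x y : X} {K : Set X} (hc : IsCompact K)
    (hK : IsPreconnected K) (hx : x ∈ K) (hy : y ∈ K) : ∃ M ⊆ K, IsIrreducibleBetween x y M := by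
  let S : Set (Set X) := {L | IsCompact L ∧ IsPreconnected L ∧ x ∈ L ∧ y ∈ L}
  have hlower : ∀ c ⊆ S, IsChain (· ⊆ ·) c → c.Nonempty → ∃ L ∈ S, ∀ s ∈ c, L ⊆ s := by
    intro c hcS hchain hne
    have : Nonempty c := hne.to_subtype
    have hdir : Directed (· ⊇ ·) fun s : c => (s : Set X) := fun a b =>
      (hchain.total a.2 b.2).elim (fun hab => ⟨a, Subset.rfl, hab⟩) fun hba => ⟨b, hba, Subset.rfl⟩
    let s₀ : c := Classical.arbitrary c
    exact ⟨⋂ s : c, s, ⟨(hcS s₀.2).1.of_isClosed_subset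
        (isClosed_iInter fun s => (hcS s.2).1.isClosed) (iInter_subset _ s₀),
      isPreconnected_iInter_of_directed hdir (fun s => (hcS s.2).1) fun s => (hcS s.2).2.1,
      mem_iInter.2 fun s => (hcS s.2).2.2.1, mem_iInter.2 fun s => (hcS s.2).2.2.2⟩,
      fun s hs => iInter_subset (fun s : c => (s : Set X)) ⟨s, hs⟩⟩
  obtain ⟨M, hMK, hM⟩ := zorn_superset_nonempty S hlower K ⟨hc, hK, hx, hy⟩
  obtain ⟨hMc, hMp, hMx, hMy⟩ := hM.prop
  exact ⟨M, hMK, hMc, hMp, hMx, hMy, fun L hL hLc hLp hLx hLy =>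
    hM.le_of_le ⟨hLc, hLp, hLx, hLy⟩ hL⟩

/-- `A` and `B` separate `x` from `y` in the complement of the open arc `U` in `M`: they are
disjoint closed sets with union `M \ U`, one containing `x` and the other `y`. -/
structure IsSeparation (x y : X) (M U A B : Set X) : Prop where
  isClosed_left : IsClosed A
  isClosed_right : IsClosed B
  disjoint : Disjoint A B
  union_eq : A ∪ B = M \ U
  left_mem : x ∈ A
  right_mem : y ∈ B

theorem IsIrreducibleBetween.exists_isSeparation [T2Space X] {x y : X} {M U : Set X}
    (hM : IsIrreducibleBetween x y M) (hU : IsOpen U) (hx : x ∉ U) (hy : y ∉ U)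
    (hne : (M ∩ U).Nonempty) : ∃ A B, IsSeparation x y M U A B := by
  let L : Set X := M \ U
  have : CompactSpace L := isCompact_iff_compactSpace.1 (hM.isCompact.diff hU)
  let x' : L := ⟨x, hM.left_mem, hx⟩
  let y' : L := ⟨y, hM.right_mem, hy⟩
  have hy' : y' ∉ connectedComponent x' := by
    intro hmem
    have hsub : ((↑) : L → X) '' connectedComponent x' ⊆ L := by
      rintro _ ⟨z, -, rfl⟩; exact z.2
    obtain ⟨p, hpM, hpU⟩ := hne
    exact (hsub <| hM.minimal _ (hsub.trans sdiff_subset)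
      (isClosed_connectedComponent.isCompact.image continuous_subtype_val)
      (isPreconnected_connectedComponent.image _ continuous_subtype_val.continuousOn)
      ⟨x', mem_connectedComponent, rfl⟩ ⟨y', hmem, rfl⟩ hpM).2 hpU
  obtain ⟨Z, hZ, hxZ, hyZ⟩ : ∃ Z : Set L, IsClopen Z ∧ x' ∈ Z ∧ y' ∉ Z := by
    rw [connectedComponent_eq_iInter_isClopen, mem_iInter] at hy'
    push Not at hy'
    obtain ⟨⟨Z, hZ, hxZ⟩, hyZ⟩ := hy'
    exact ⟨Z, hZ, hxZ, hyZ⟩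
  exact ⟨(↑) '' Z, (↑) '' Zᶜ, {
    isClosed_left := (hZ.1.isCompact.image continuous_subtype_val).isClosed
    isClosed_right := (hZ.compl.1.isCompact.image continuous_subtype_val).isClosed
    disjoint := (disjoint_image_iff Subtype.val_injective).2 disjoint_compl_right
    union_eq := by rw [← image_union, union_compl_self, image_univ, Subtype.range_coe]
    left_mem := ⟨x', hxZ, rfl⟩
    right_mem := ⟨y', hyZ, rfl⟩ }⟩

namespace IsSeparation

variable {x y : X} {M U A B : Set X} {h : unitInterval → X}

theorem symm (hs : IsSeparation x y M U A B) : IsSeparation y x M U B A :=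
  ⟨hs.isClosed_right, hs.isClosed_left, hs.disjoint.symm, union_comm A B ▸ hs.union_eq,
    hs.right_mem, hs.left_mem⟩

theorem subset_left (hs : IsSeparation x y M U A B) : A ⊆ M \ U :=
  subset_union_left.trans hs.union_eq.subset

theorem subset_union (hs : IsSeparation x y M U A B) : M ⊆ A ∪ B ∪ U := by
  rw [hs.union_eq, sdiff_union_self]
  exact subset_union_left

theorem eq_zero_or_eq_one_of_mem_left (hs : IsSeparation x y M (h '' Ioo 0 1) A B)
    {s : unitInterval} (hsA : h s ∈ A) : s = 0 ∨ s = 1 := by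
  by_contra! hn
  exact (hs.subset_left hsA).2
    ⟨s, ⟨unitInterval.pos_iff_ne_zero.2 hn.1, unitInterval.lt_one_iff_ne_one.2 hn.2⟩, rfl⟩

theorem eq_zero_of_mem_left (hs : IsSeparation x y M (h '' Ioo 0 1) A B) (h1 : h 1 ∈ B)
    {s : unitInterval} (hsA : h s ∈ A) : s = 0 :=
  (hs.eq_zero_or_eq_one_of_mem_left hsA).resolve_right fun e =>
    disjoint_left.1 hs.disjoint (e ▸ hsA) h1

theorem eq_one_of_mem_right (hs : IsSeparation x y M (h '' Ioo 0 1) A B) (h0 : h 0 ∈ A)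
    {s : unitInterval} (hsB : h s ∈ B) : s = 1 :=
  (hs.symm.eq_zero_or_eq_one_of_mem_left hsB).resolve_left fun e =>
    disjoint_right.1 hs.disjoint (e ▸ hsB) h0

theorem zero_mem_left_or_one_mem_left [T2Space X] (hs : IsSeparation x y M (h '' Ioo 0 1) A B)
    (hM : IsPreconnected M) (hy : y ∈ M) (hc : Continuous h) : h 0 ∈ A ∨ h 1 ∈ A := by
  by_contra! hn
  have hMA : M ⊆ A := subset_left_of_isPreconnected_of_isClosed hM hs.isClosed_left
    (hs.isClosed_right.union (isCompact_range hc).isClosed)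
    (hs.subset_union.trans (by rw [← union_assoc]; gcongr; exact image_subset_range _ _))
    (fun z _ hzA hz => hz.elim (disjoint_left.1 hs.disjoint hzA) (by
      rintro ⟨s, rfl⟩
      rcases hs.eq_zero_or_eq_one_of_mem_left hzA with rfl | rfl
      exacts [hn.1 hzA, hn.2 hzA]))
    ⟨x, (hs.subset_left hs.left_mem).1, hs.left_mem⟩
  exact disjoint_left.1 hs.disjoint (hMA hy) hs.right_mem

theorem range_subset [T2Space X] (hs : IsSeparation x y M (h '' Ioo 0 1) A B)
    (hM : IsPreconnected M) (hc : Continuous h) (hi : Function.Injective h)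
    (h0 : h 0 ∈ A) (h1 : h 1 ∈ B) : range h ⊆ M := by
  rintro _ ⟨s, rfl⟩
  by_contra hsM
  have hs0 : s ≠ 0 := by rintro rfl; exact hsM (hs.subset_left h0).1
  have hs1 : s ≠ 1 := by rintro rfl; exact hsM (hs.symm.subset_left h1).1
  have hMA : M ⊆ A ∪ h '' Iic s := subset_left_of_isPreconnected_of_isClosed hM
    (hs.isClosed_left.union (isClosed_Iic.isCompact.image hc).isClosed)
    (hs.isClosed_right.union (isClosed_Ici.isCompact.image hc).isClosed)
    (fun z hz => by
      rcases hs.subset_union hz with (hzA | hzB) | ⟨r, -, rfl⟩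
      · exact Or.inl (Or.inl hzA)
      · exact Or.inr (Or.inl hzB)
      · exact (le_total r s).imp (fun hr => Or.inr ⟨r, hr, rfl⟩) fun hr => Or.inr ⟨r, hr, rfl⟩)
    (fun z hz => by
      rintro (hzA | ⟨r, hr, rfl⟩) (hzB | ⟨r', hr', e⟩)
      · exact disjoint_left.1 hs.disjoint hzA hzB
      · obtain rfl := hs.eq_zero_of_mem_left h1 (e ▸ hzA)
        exact hs0 (le_antisymm hr' unitInterval.nonneg')
      · obtain rfl := hs.eq_one_of_mem_right h0 hzB
        exact hs1 (le_antisymm unitInterval.le_one' hr)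
      · obtain rfl := hi e
        exact hsM (le_antisymm (mem_Iic.1 hr) (mem_Ici.1 hr') ▸ hz))
    ⟨x, (hs.subset_left hs.left_mem).1, Or.inl hs.left_mem⟩
  rcases hMA (hs.symm.subset_left hs.right_mem).1 with hyA | ⟨r, hr, hry⟩
  · exact disjoint_left.1 hs.disjoint hyA hs.right_mem
  · obtain rfl := hs.eq_one_of_mem_right h0 (hry ▸ hs.right_mem)
    exact hs1 (le_antisymm unitInterval.le_one' hr)

end IsSeparation

end Continua

section Crossing

variable {X : Type*} [TopologicalSpace X] {x y : X} {M A B : Set X} {h : unitInterval → X}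

theorem exists_continuousOn_extend_param [T2Space X] (hA : IsClosed A) (hB : IsClosed B)
    (hAB : Disjoint A B) (hc : Continuous h) (hi : Function.Injective h)
    (h0 : ∀ s, h s ∈ A → s = 0) (h1 : ∀ s, h s ∈ B → s = 1) :
    ∃ φ : X → ℝ, ContinuousOn φ (A ∪ B ∪ range h) ∧ (∀ p ∈ A, φ p = 0) ∧ (∀ p ∈ B, φ p = 1) ∧
      ∀ s, φ (h s) = s := by
  classical
  let φ : X → ℝ := fun p =>
    if p ∈ A then 0 else if p ∈ B then 1 else (Function.invFun h p : unitInterval)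
  have hφA : ∀ p ∈ A, φ p = 0 := fun p hp => if_pos hp
  have hφB : ∀ p ∈ B, φ p = 1 := fun p hp => by
    simp only [φ, if_neg (disjoint_right.1 hAB hp), if_pos hp]
  have hφh : ∀ s, φ (h s) = s := fun s => by
    by_cases hsA : h s ∈ A
    · rw [hφA _ hsA, h0 s hsA, Icc.coe_zero]
    by_cases hsB : h s ∈ B
    · rw [hφB _ hsB, h1 s hsB, Icc.coe_one]
    simp only [φ, if_neg hsA, if_neg hsB, Function.leftInverse_invFun hi s]
  refine ⟨φ, ?_, hφA, hφB, hφh⟩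
  refine ((continuousOn_const.congr hφA).union_of_isClosed (continuousOn_const.congr hφB) hA
    hB).union_of_isClosed ?_ (hA.union hB) (isCompact_range hc).isClosed
  rw [← image_univ, (hc.isClosedEmbedding hi).isInducing.continuousOn_image_iff]
  exact (continuous_subtype_val.congr fun s => (hφh s).symm).continuousOn

/-- `φ` is a monotone passage of `M` from `x` to `y` along the open arc `J`: it has values in
`[0, 1]`, is `0` at `x` and `1` at `y`, and `J` is the part of `M` where `0 < φ < 1`, on which `φ`
is injective. -/
structure IsCrossing (x y : X) (M J : Set X) (φ : X → ℝ) : Prop where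
  continuousOn : ContinuousOn φ M
  map_mem : ∀ p ∈ M, φ p ∈ Icc (0 : ℝ) 1
  left : φ x = 0
  right : φ y = 1
  isPreconnected : IsPreconnected J
  injOn : InjOn φ J
  inter_preimage_Ioo : M ∩ φ ⁻¹' Ioo 0 1 = J

theorem IsSeparation.exists_isCrossing [T2Space X] (hs : IsSeparation x y M (h '' Ioo 0 1) A B)
    (hM : IsPreconnected M) (hc : Continuous h) (hi : Function.Injective h)
    (h0 : h 0 ∈ A) (h1 : h 1 ∈ B) : ∃ φ, IsCrossing x y M (h '' Ioo 0 1) φ := by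
  obtain ⟨φ, hφc, hφA, hφB, hφh⟩ := exists_continuousOn_extend_param hs.isClosed_left
    hs.isClosed_right hs.disjoint hc hi (fun _ => hs.eq_zero_of_mem_left h1)
    fun _ => hs.eq_one_of_mem_right h0
  have hsub : M ⊆ A ∪ B ∪ range h :=
    hs.subset_union.trans (union_subset_union_right _ (image_subset_range _ _))
  refine ⟨φ, hφc.mono hsub, fun p hp => ?_, hφA x hs.left_mem, hφB y hs.right_mem,
    isPreconnected_image_Ioo hc, ?_, Subset.antisymm ?_ ?_⟩
  · rcases hsub hp with (hpA | hpB) | ⟨s, rfl⟩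
    · rw [hφA p hpA]; exact unitInterval.zero_mem
    · rw [hφB p hpB]; exact unitInterval.one_mem
    · rw [hφh]; exact s.2
  · rintro _ ⟨s, -, rfl⟩ _ ⟨t, -, rfl⟩ hst
    rw [hφh, hφh] at hst
    rw [Subtype.ext hst]
  · rintro p ⟨hp, hp0, hp1⟩
    rcases hsub hp with (hpA | hpB) | ⟨s, rfl⟩
    · exact absurd (hφA p hpA) hp0.ne'
    · exact absurd (hφB p hpB) hp1.ne
    · rw [hφh] at hp0 hp1
      exact ⟨s, ⟨hp0, hp1⟩, rfl⟩
  · rintro _ ⟨s, hs01, rfl⟩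
    refine ⟨hs.range_subset hM hc hi h0 h1 (mem_range_self s), ?_⟩
    rw [mem_preimage, hφh]
    exact hs01

theorem image_symm_Ioo {α : Type*} (h : unitInterval → α) :
    (h ∘ unitInterval.symm) '' Ioo 0 1 = h '' Ioo 0 1 := by
  rw [image_comp, unitInterval.symm_involutive.image_eq_preimage_symm]
  congr 1
  ext s
  simp only [mem_preimage, mem_Ioo, unitInterval.pos_iff_ne_zero, unitInterval.lt_one_iff_ne_one,
    ne_eq, unitInterval.symm_eq_zero, unitInterval.symm_eq_one]
  exact and_comm

theorem IsIrreducibleBetween.exists_isCrossing [T2Space X] (hM : IsIrreducibleBetween x y M)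
    (hc : Continuous h) (hi : Function.Injective h) (ho : IsOpen (h '' Ioo 0 1))
    (hx : x ∉ h '' Ioo 0 1) (hy : y ∉ h '' Ioo 0 1) (hne : (M ∩ h '' Ioo 0 1).Nonempty) :
    ∃ φ, IsCrossing x y M (h '' Ioo 0 1) φ := by
  obtain ⟨A, B, hs⟩ := hM.exists_isSeparation ho hx hy hne
  have hMp := hM.isPreconnected
  rcases hs.zero_mem_left_or_one_mem_left hMp hM.right_mem hc with h0A | h1A <;>
    rcases hs.symm.zero_mem_left_or_one_mem_left hMp hM.left_mem hc with h0B | h1B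
  · exact (disjoint_left.1 hs.disjoint h0A h0B).elim
  · exact hs.exists_isCrossing hMp hc hi h0A h1B
  · rw [← image_symm_Ioo] at hs ⊢
    exact hs.exists_isCrossing hMp (hc.comp unitInterval.continuous_symm)
      (hi.comp unitInterval.symm_bijective.injective) (by simpa using h1A) (by simpa using h0B)
  · exact (disjoint_left.1 hs.disjoint h1A h1B).elim

namespace IsCrossing

variable {J J' : Set X} {φ φ' : X → ℝ}

theorem subset (hφ : IsCrossing x y M J φ) : J ⊆ M :=
  hφ.inter_preimage_Ioo.symm.subset.trans inter_subset_left

theorem mem_iff (hφ : IsCrossing x y M J φ) {p : X} (hp : p ∈ M) : p ∈ J ↔ φ p ∈ Ioo (0 : ℝ) 1 := by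
  rw [← hφ.inter_preimage_Ioo, mem_inter_iff, and_iff_right hp, mem_preimage]

theorem eq_zero_or_eq_one (hφ : IsCrossing x y M J φ) {p : X} (hp : p ∈ M) (hpJ : p ∉ J) :
    φ p = 0 ∨ φ p = 1 := by
  rw [hφ.mem_iff hp] at hpJ
  have := hφ.map_mem p hp
  grind

theorem eqOn_zero_or_eqOn_one (hφ : IsCrossing x y M J φ) (hJ' : IsPreconnected J')
    (hsub : J' ⊆ M) (hd : Disjoint J J') : (∀ p ∈ J', φ p = 0) ∨ ∀ p ∈ J', φ p = 1 := by
  have hmaps : MapsTo φ J' {0, 1} := fun p hp =>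
    hφ.eq_zero_or_eq_one (hsub hp) (disjoint_right.1 hd hp)
  have hconst : ∀ p ∈ J', ∀ q ∈ J', φ p = φ q := fun p hp q hq =>
    hJ'.constant_of_mapsTo (toFinite {0, 1}).isDiscrete (hφ.continuousOn.mono hsub) hmaps hp hq
  by_contra! hn
  obtain ⟨⟨p, hp, hp0⟩, q, hq, hq1⟩ := hn
  exact hq1 (hconst q hq p hp ▸ (hmaps hp).resolve_left hp0)

theorem exists_forall_eq_or_eq (hφ : IsCrossing x y M J φ) (hφ' : IsCrossing x y M J' φ')
    (hM : IsPreconnected M) (hMc : IsClosed M) (hx : x ∈ M) (hy : y ∈ M) (hd : Disjoint J J') :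
    ∃ a b : ℝ, ∀ p ∈ M, φ p = b ∨ φ' p = a := by
  obtain ⟨a, b, ha, hb, hJ, hJ'⟩ : ∃ a b : ℝ, (a = 0 ∨ a = 1) ∧ (b = 0 ∨ b = 1) ∧
      (∀ p ∈ J, φ' p = a) ∧ ∀ p ∈ J', φ p = b := by
    rcases hφ'.eqOn_zero_or_eqOn_one hφ.isPreconnected hφ.subset hd.symm with h | h <;>
    rcases hφ.eqOn_zero_or_eqOn_one hφ'.isPreconnected hφ'.subset hd with h' | h' <;>
    exact ⟨_, _, by simp, by simp, h, h'⟩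
  refine ⟨a, b, fun p hp => ?_⟩
  have hcl : ∀ (c : ℝ) {ψ : X → ℝ}, ContinuousOn ψ M → IsClosed (M ∩ ψ ⁻¹' {c}) :=
    fun c ψ hψ => hψ.preimage_isClosed_of_isClosed hMc isClosed_singleton
  have hends : (φ x = b ∨ φ' x = a) ∨ φ y = b ∨ φ' y = a := by
    rw [hφ.left, hφ'.left, hφ.right, hφ'.right]
    grind
  -- Off the claimed set `(φ, φ')` takes the single value `(1 - b, 1 - a)`.
  have hsub : M ⊆ (M ∩ φ ⁻¹' {b}) ∪ (M ∩ φ' ⁻¹' {a}) := by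
    refine subset_left_of_isPreconnected_of_isClosed hM
      (B := (M ∩ φ ⁻¹' {1 - b}) ∩ (M ∩ φ' ⁻¹' {1 - a}))
      ((hcl b hφ.continuousOn).union (hcl a hφ'.continuousOn))
      ((hcl _ hφ.continuousOn).inter (hcl _ hφ'.continuousOn)) (fun q hq => ?_)
      (fun q hq => ?_) (hends.elim (fun h => ⟨x, hx, by simpa [hx] using h⟩)
        fun h => ⟨y, hy, by simpa [hy] using h⟩)
    · have h₁ := hφ.eq_zero_or_eq_one hq
      have h₂ := hφ'.eq_zero_or_eq_one hq
      have h₃ := hJ q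
      have h₄ := hJ' q
      simp only [mem_union, mem_inter_iff, mem_preimage, mem_singleton_iff, hq, true_and]
      grind
    · simp only [mem_union, mem_inter_iff, mem_preimage, mem_singleton_iff, hq, true_and]
      grind
  simpa [hp] using hsub hp

theorem monovaryOn (hφ : IsCrossing x y M J φ) (hφ' : IsCrossing x y M J' φ')
    (hM : IsPreconnected M) (hMc : IsClosed M) (hx : x ∈ M) (hy : y ∈ M) (hd : Disjoint J J') :
    MonovaryOn φ' φ M := by
  obtain ⟨a, b, hab⟩ := hφ.exists_forall_eq_or_eq hφ' hM hMc hx hy hd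
  have hxab := hab x hx
  have hyab := hab y hy
  rw [hφ.left, hφ'.left] at hxab
  rw [hφ.right, hφ'.right] at hyab
  intro p hp q hq hlt
  have hpab := hab p hp
  have hqab := hab q hq
  have hφp := hφ.map_mem p hp
  have hφq := hφ.map_mem q hq
  have hφp' := hφ'.map_mem p hp
  have hφq' := hφ'.map_mem q hq
  grind

end IsCrossing

end Crossing

section Fibres

variable {X : Type*} [TopologicalSpace X] {M : Set X} {φ : X → ℝ}

theorem isPreconnected_inter_preimage_Ici_of_subsingleton (hM : IsPreconnected M)
    (hMc : IsClosed M) (hφ : ContinuousOn φ M) {c : ℝ} (hc : (M ∩ φ ⁻¹' {c}).Subsingleton) :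
    IsPreconnected (M ∩ φ ⁻¹' Ici c) := by
  have hle : IsClosed (M ∩ φ ⁻¹' Iic c) := hφ.preimage_isClosed_of_isClosed hMc isClosed_Iic
  have hge : IsClosed (M ∩ φ ⁻¹' Ici c) := hφ.preimage_isClosed_of_isClosed hMc isClosed_Ici
  have key : ∀ A B : Set X, IsClosed A → IsClosed B → M ∩ φ ⁻¹' Ici c ⊆ A ∪ B → Disjoint A B →
      Disjoint (M ∩ φ ⁻¹' {c}) B → M ∩ φ ⁻¹' Ici c ⊆ A ∨ M ∩ φ ⁻¹' Ici c ⊆ B := by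
    intro A B hA hB hcover hAB hcB
    have hfib : ∀ z ∈ M, φ z = c → z ∉ B := fun z hz hzc => disjoint_left.1 hcB ⟨hz, hzc⟩
    refine (isPreconnected_iff_subset_of_disjoint_closed.1 hM
      (M ∩ φ ⁻¹' Iic c ∪ M ∩ φ ⁻¹' Ici c ∩ A) (M ∩ φ ⁻¹' Ici c ∩ B) (hle.union (hge.inter hA))
      (hge.inter hB) (fun z hz => ?_) (eq_empty_of_forall_notMem ?_)).imp (fun h z hz => ?_)
      fun h z hz => (h hz.1).2
    · rcases le_total (φ z) c with hzc | hzc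
      · exact Or.inl (Or.inl ⟨hz, hzc⟩)
      · exact (hcover ⟨hz, hzc⟩).imp (fun hzA => Or.inr ⟨⟨hz, hzc⟩, hzA⟩)
          fun hzB => ⟨⟨hz, hzc⟩, hzB⟩
    · rintro z ⟨hz, ⟨-, hzc⟩ | ⟨-, hzA⟩, ⟨-, hzc'⟩, hzB⟩
      · exact hfib z hz (le_antisymm hzc hzc') hzB
      · exact disjoint_left.1 hAB hzA hzB
    · rcases h hz.1 with ⟨-, hzc⟩ | ⟨-, hzA⟩
      · exact (hcover hz).resolve_right (hfib z hz.1 (le_antisymm hzc hz.2))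
      · exact hzA
  rw [isPreconnected_iff_subset_of_fully_disjoint_closed hge]
  intro A B hA hB hcover hAB
  by_cases hcB : Disjoint (M ∩ φ ⁻¹' {c}) B
  · exact key A B hA hB hcover hAB hcB
  · obtain ⟨p, hp, hpB⟩ := not_disjoint_iff.1 hcB
    refine (key B A hB hA (union_comm A B ▸ hcover) hAB.symm ?_).symm
    exact disjoint_left.2 fun q hq hqA => disjoint_left.1 hAB hqA (hc hp hq ▸ hpB)

theorem isPreconnected_inter_preimage_Ici [T2Space X] (hM : IsPreconnected M) (hMc : IsCompact M)
    (hφ : ContinuousOn φ M) {C : Set ℝ} (hC : C.Countable)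
    (hfib : ∀ c ∉ C, (M ∩ φ ⁻¹' {c}).Subsingleton) (c : ℝ) : IsPreconnected (M ∩ φ ⁻¹' Ici c) := by
  have hCd : Dense Cᶜ := hC.dense_compl ℝ
  let ι := {a : ℝ // a ∉ C ∧ a < c}
  have : Nonempty ι := by
    obtain ⟨a, ha, -, hac⟩ := hCd.exists_between (sub_one_lt c)
    exact ⟨a, ha, hac⟩
  have heq : M ∩ φ ⁻¹' Ici c = ⋂ a : ι, M ∩ φ ⁻¹' Ici (a : ℝ) := by
    ext z
    rw [mem_iInter]
    refine ⟨fun hz a => ⟨hz.1, a.2.2.le.trans hz.2⟩, fun hz =>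
      ⟨(hz (Classical.arbitrary ι)).1, ?_⟩⟩
    by_contra! hlt
    obtain ⟨a, ha, hza, hac⟩ := hCd.exists_between (not_le.1 hlt)
    exact (hz ⟨a, ha, hac⟩).2.not_gt hza
  have hanti : ∀ a b : ℝ, a ≤ b → M ∩ φ ⁻¹' Ici b ⊆ M ∩ φ ⁻¹' Ici a := fun a b hab =>
    inter_subset_inter_right _ (preimage_mono (Ici_subset_Ici.2 hab))
  rw [heq]
  refine isPreconnected_iInter_of_directed (fun a b => ?_) (fun a => ?_) fun a =>
    isPreconnected_inter_preimage_Ici_of_subsingleton hM hMc.isClosed hφ (hfib a a.2.1)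
  · exact (le_total (a : ℝ) b).elim (fun h => ⟨b, hanti _ _ h, Subset.rfl⟩)
      fun h => ⟨a, Subset.rfl, hanti _ _ h⟩
  · exact hMc.of_isClosed_subset
      (hφ.preimage_isClosed_of_isClosed hMc.isClosed isClosed_Ici) inter_subset_left

theorem isPreconnected_inter_preimage_singleton [T2Space X] (hM : IsPreconnected M)
    (hMc : IsCompact M) (hφ : ContinuousOn φ M) {C : Set ℝ} (hC : C.Countable)
    (hfib : ∀ c ∉ C, (M ∩ φ ⁻¹' {c}).Subsingleton) (c : ℝ) :
    IsPreconnected (M ∩ φ ⁻¹' {c}) := by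
  have hge : IsCompact (M ∩ φ ⁻¹' Ici c) := hMc.of_isClosed_subset
    (hφ.preimage_isClosed_of_isClosed hMc.isClosed isClosed_Ici) inter_subset_left
  have hneg := isPreconnected_inter_preimage_Ici
    (isPreconnected_inter_preimage_Ici hM hMc hφ hC hfib c) hge
    (hφ.mono inter_subset_left).neg (hC.image Neg.neg) (fun b hb =>
      (hfib (-b) fun hC => hb ⟨-b, hC, neg_neg b⟩).anti ?_) (-c)
  · convert hneg using 1
    ext z
    simp only [mem_inter_iff, mem_preimage, mem_singleton_iff, mem_Ici, neg_le_neg_iff,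
      Pi.neg_apply, and_assoc, le_antisymm_iff]
    tauto
  · rintro z ⟨⟨hz, -⟩, hzb⟩
    exact ⟨hz, neg_eq_iff_eq_neg.1 hzb⟩

theorem injOn_of_forall_notMem_countable {X : Type*} [MetricSpace X] {M : Set X} {φ : X → ℝ}
    (hM : IsPreconnected M) (hMc : IsCompact M) (hφ : ContinuousOn φ M) {Q : Set X}
    (hQ : Q.Countable) (hinj : ∀ p ∈ M, p ∉ Q → ∀ q ∈ M, φ p = φ q → p = q) : InjOn φ M := by
  have hfib : ∀ c ∉ φ '' Q, (M ∩ φ ⁻¹' {c}).Subsingleton := fun c hc p hp q hq =>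
    hinj p hp.1 (fun hpQ => hc ⟨p, hpQ, hp.2⟩) q hq.1 (hp.2.trans hq.2.symm)
  intro p hp q hq hpq
  by_contra hne
  have hsub : M ∩ φ ⁻¹' {φ p} ⊆ Q := fun z ⟨hz, hzp⟩ => by
    by_contra hzQ
    exact hne ((hinj z hz hzQ p hp hzp).symm.trans (hinj z hz hzQ q hq (hzp.trans hpq)))
  exact hne (hQ.isTotallyDisconnected _ hsub
    (isPreconnected_inter_preimage_singleton hM hMc hφ (hQ.image φ) hfib (φ p))
    ⟨hp, rfl⟩ ⟨hq, hpq.symm⟩)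

theorem isArcBetween_of_injOn {M : Set X} {φ : X → ℝ} {x y : X}
    (hMc : IsCompact M) (hM : IsPreconnected M)
    (hφ : ContinuousOn φ M) (hinj : InjOn φ M) (hx : x ∈ M) (hy : y ∈ M) (hxy : x ≠ y)
    (hmaps : MapsTo φ M (Icc (φ x) (φ y))) : IsArcBetween x y M := by
  have hlt : φ x < φ y := (hmaps hy).1.lt_of_ne fun h => hxy (hinj hx hy h)
  have : CompactSpace M := isCompact_iff_compactSpace.1 hMc
  have hbij : BijOn φ M (Icc (φ x) (φ y)) :=
    ⟨hmaps, hinj, hM.intermediate_value hx hy hφ⟩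
  let e : M ≃ₜ unitInterval :=
    (Continuous.homeoOfEquivCompactToT2 (f := hbij.equiv φ) (hφ.mapsToRestrict hmaps)).trans
      (iccHomeoI _ _ hlt)
  have he : ∀ p : M, (e p : ℝ) = (φ p - φ x) / (φ y - φ x) := fun _ => rfl
  have hex : e ⟨x, hx⟩ = 0 := Subtype.ext (by rw [he, sub_self, zero_div, Icc.coe_zero])
  have hey : e ⟨y, hy⟩ = 1 :=
    Subtype.ext (by rw [he, div_self (sub_pos.2 hlt).ne', Icc.coe_one])
  refine ⟨(↑) ∘ e.symm, continuous_subtype_val.comp e.symm.continuous,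
    Subtype.val_injective.comp e.symm.injective, ?_, ?_, ?_⟩
  · rw [e.symm.surjective.range_comp, Subtype.range_coe]
  · rw [← hex, Function.comp_apply, e.symm_apply_apply]
  · rw [← hey, Function.comp_apply, e.symm_apply_apply]

end Fibres

section ArcFamily

variable {G : Type*} [TopologicalSpace G] {ι : Type*}

/-- A family of parametrized free arcs with disjoint interiors, covering the space up to a
countable set. -/
structure IsArcFamily (h : ι → unitInterval → G) : Prop where
  continuous : ∀ w, Continuous (h w)
  injective : ∀ w, Function.Injective (h w)
  isOpen : ∀ w, IsOpen (h w '' Ioo 0 1)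
  disjoint : ∀ w w', w ≠ w' → Disjoint (h w '' Ioo 0 1) (h w' '' Ioo 0 1)
  countable_compl : (⋃ w, h w '' Ioo 0 1)ᶜ.Countable

theorem exists_injOn_of_isCrossing {G : Type*} [MetricSpace G] [Countable ι]
    {M : Set G} {x y : G} {J : ι → Set G}
    {φ : ι → G → ℝ} (hM : IsPreconnected M) (hMc : IsCompact M) (hx : x ∈ M) (hy : y ∈ M)
    (hφ : ∀ w, IsCrossing x y M (J w) (φ w)) (hd : Pairwise fun w w' => Disjoint (J w) (J w'))
    (hQ : (M \ ⋃ w, J w).Countable) :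
    ∃ Φ : G → ℝ, ContinuousOn Φ M ∧ InjOn Φ M ∧ MapsTo Φ M (Icc (Φ x) (Φ y)) := by
  have : Encodable ι := Encodable.ofCountable ι
  obtain ⟨c, hc, C, hC, -⟩ := posSumOfEncodable one_pos ι
  have hnonneg : ∀ w, ∀ p ∈ M, 0 ≤ c w * φ w p := fun w p hp =>
    mul_nonneg (hc w).le ((hφ w).map_mem p hp).1
  have hle : ∀ w, ∀ p ∈ M, c w * φ w p ≤ c w := fun w p hp =>
    mul_le_of_le_one_right (hc w).le ((hφ w).map_mem p hp).2
  have hsum : ∀ p ∈ M, Summable fun w => c w * φ w p := fun p hp =>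
    hC.summable.of_nonneg_of_le (hnonneg · p hp) (hle · p hp)
  let Φ : G → ℝ := fun p => ∑' w, c w * φ w p
  have hlt : ∀ w, ∀ p ∈ M, ∀ q ∈ M, φ w p < φ w q → Φ p < Φ q := by
    refine fun w p hp q hq hpq => (hsum p hp).tsum_lt_tsum (i := w) (fun w' => ?_)
      (mul_lt_mul_of_pos_left hpq (hc w)) (hsum q hq)
    gcongr
    · exact (hc w').le
    · rcases eq_or_ne w w' with rfl | hww'
      · exact hpq.le
      · exact (hφ w).monovaryOn (hφ w') hM hMc.isClosed hx hy (hd hww') hp hq hpq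
  have hcont : ContinuousOn Φ M := continuousOn_tsum
    (fun w => continuousOn_const.mul (hφ w).continuousOn) hC.summable fun w p hp =>
      (Real.norm_of_nonneg (hnonneg w p hp)).trans_le (hle w p hp)
  refine ⟨Φ, hcont, injOn_of_forall_notMem_countable hM hMc hcont hQ ?_, fun p hp => ⟨?_, ?_⟩⟩
  · intro p hp hpQ q hq heq
    obtain ⟨w, hw⟩ : ∃ w, p ∈ J w := by simpa [hp] using hpQ
    have hpq : φ w p = φ w q := le_antisymm
      (not_lt.1 fun h => (hlt w q hq p hp h).ne' heq) (not_lt.1 fun h => (hlt w p hp q hq h).ne heq)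
    refine (hφ w).injOn hw (((hφ w).mem_iff hq).2 ?_) hpq
    exact hpq ▸ ((hφ w).mem_iff hp).1 hw
  · refine (hsum x hx).tsum_le_tsum (fun w => ?_) (hsum p hp)
    rw [(hφ w).left, mul_zero]
    exact hnonneg w p hp
  · refine (hsum p hp).tsum_le_tsum (fun w => ?_) (hsum y hy)
    rw [(hφ w).right, mul_one]
    exact hle w p hp

theorem IsArcFamily.exists_isArcBetween_of_notMem {G : Type*} [MetricSpace G] [Countable ι]
    {h : ι → unitInterval → G} (hh : IsArcFamily h) {x y : G}
    (hx : ∀ w, x ∉ h w '' Ioo 0 1) (hy : ∀ w, y ∉ h w '' Ioo 0 1)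
    {K : Set G} (hc : IsCompact K) (hK : IsPreconnected K) (hxK : x ∈ K) (hyK : y ∈ K)
    (hxy : x ≠ y) : ∃ γ ⊆ K, IsArcBetween x y γ := by
  obtain ⟨M, hMK, hM⟩ := exists_isIrreducibleBetween hc hK hxK hyK
  let κ := {w : ι // (M ∩ h w '' Ioo 0 1).Nonempty}
  choose φ hφ using fun w : κ => hM.exists_isCrossing (hh.continuous w) (hh.injective w)
    (hh.isOpen w) (hx w) (hy w) w.2
  have hQ : (M \ ⋃ w : κ, h w '' Ioo 0 1).Countable := by
    refine hh.countable_compl.mono ?_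
    rintro z ⟨hz, hzκ⟩ hzι
    obtain ⟨w, hw⟩ := mem_iUnion.1 hzι
    exact hzκ (mem_iUnion.2 ⟨⟨w, z, hz, hw⟩, hw⟩)
  obtain ⟨Φ, hcont, hinj, hmaps⟩ := exists_injOn_of_isCrossing hM.isPreconnected hM.isCompact
    hM.left_mem hM.right_mem hφ (fun w w' hww' => hh.disjoint _ _ (Subtype.val_injective.ne hww'))
    hQ
  exact ⟨M, hMK, isArcBetween_of_injOn hM.isCompact hM.isPreconnected hcont hinj hM.left_mem
    hM.right_mem hxy hmaps⟩

theorem exists_reparam_Ioo {a b : unitInterval} (hab : a < b) :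
    ∃ θ : unitInterval → unitInterval, Continuous θ ∧ Function.Injective θ ∧
      θ '' Ioo 0 1 = Ioo a b := by
  have hI : Icc (a : ℝ) b ⊆ Icc 0 1 := Icc_subset_Icc a.2.1 b.2.2
  let e := (iccHomeoI (a : ℝ) b hab).symm
  refine ⟨fun s => inclusion hI (e s), (continuous_inclusion hI).comp e.continuous,
    (inclusion_injective hI).comp e.injective, ?_⟩
  have hpos : (0 : ℝ) < b - a := sub_pos.2 hab
  ext r
  constructor
  · rintro ⟨s, ⟨hs0, hs1⟩, rfl⟩
    have hs0' : (0 : ℝ) < s := hs0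
    have hs1' : (s : ℝ) < 1 := hs1
    constructor
    · change (a : ℝ) < (b - a) * s + a
      nlinarith
    · change ((b - a) * s + a : ℝ) < b
      nlinarith
  · rintro ⟨har, hrb⟩
    refine ⟨e.symm ⟨r, har.le, hrb.le⟩, ⟨?_, ?_⟩, Subtype.ext (by simp)⟩
    · exact div_pos (sub_pos.2 (Subtype.coe_lt_coe.2 har)) hpos
    · exact (div_lt_one hpos).2 (sub_lt_sub_right (Subtype.coe_lt_coe.2 hrb) _)

theorem IsArcFamily.eq_of_apply_eq {h : ι → unitInterval → G} (hh : IsArcFamily h) {w w' : ι}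
    {s s' : unitInterval} (hs : s ∈ Ioo 0 1) (hs' : s' ∈ Ioo 0 1) (heq : h w s = h w' s') :
    w = w' := by
  by_contra hne
  exact disjoint_left.1 (hh.disjoint w w' hne) ⟨s, hs, rfl⟩ ⟨s', hs', heq.symm⟩

theorem IsArcFamily.iUnion_image_sdiff_singleton {h : ι → unitInterval → G} (hh : IsArcFamily h)
    {t : ι → unitInterval} (ht : ∀ w, t w ∈ Ioo 0 1) :
    ⋃ w, h w '' (Ioo 0 1 \ {t w}) = (⋃ w, h w '' Ioo 0 1) \ range fun w => h w (t w) := by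
  ext z
  constructor
  · intro hz
    obtain ⟨w, s, ⟨hs, hst⟩, rfl⟩ := mem_iUnion.1 hz
    refine ⟨mem_iUnion.2 ⟨w, s, hs, rfl⟩, ?_⟩
    rintro ⟨w', hw'⟩
    obtain rfl := hh.eq_of_apply_eq (ht w') hs hw'
    exact hst (hh.injective _ hw').symm
  · rintro ⟨hz, hzt⟩
    obtain ⟨w, s, hs, rfl⟩ := mem_iUnion.1 hz
    exact mem_iUnion.2 ⟨w, s, ⟨hs, fun h => hzt ⟨w, by rw [h]⟩⟩, rfl⟩

theorem IsArcFamily.exists_split [T2Space G] [Countable ι] {h : ι → unitInterval → G}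
    (hh : IsArcFamily h) {t : ι → unitInterval} (ht : ∀ w, t w ∈ Ioo 0 1) :
    ∃ h' : ι × Bool → unitInterval → G, IsArcFamily h' ∧
      ⋃ w, h' w '' Ioo 0 1 = (⋃ w, h w '' Ioo 0 1) \ range fun w => h w (t w) := by
  let l : ι × Bool → unitInterval := fun p => if p.2 then t p.1 else 0
  let r : ι × Bool → unitInterval := fun p => if p.2 then 1 else t p.1
  have hlr : ∀ p, l p < r p := by
    rintro ⟨w, _ | _⟩
    exacts [(ht w).1, (ht w).2]
  have hsub : ∀ p, Ioo (l p) (r p) ⊆ Ioo 0 1 := fun p =>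
    Ioo_subset_Ioo unitInterval.nonneg' unitInterval.le_one'
  choose θ hθc hθi hθ using fun p => exists_reparam_Ioo (hlr p)
  have himage : ∀ p : ι × Bool, (h p.1 ∘ θ p) '' Ioo 0 1 = h p.1 '' Ioo (l p) (r p) := fun p => by
    rw [image_comp, hθ]
  have hUnion : ⋃ p : ι × Bool, (h p.1 ∘ θ p) '' Ioo 0 1 =
      (⋃ w, h w '' Ioo 0 1) \ range fun w => h w (t w) := by
    simp_rw [himage]
    rw [← hh.iUnion_image_sdiff_singleton ht, iUnion_prod']
    refine iUnion_congr fun w => ?_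
    rw [iUnion, iSup_bool_eq]
    change h w '' Ioo (t w) 1 ∪ h w '' Ioo 0 (t w) = _
    rw [← image_union]
    congr 1
    ext s
    have := ht w
    simp only [mem_union, mem_Ioo, Set.mem_sdiff, mem_singleton_iff] at this ⊢
    grind
  refine ⟨fun p => h p.1 ∘ θ p, ⟨fun p => (hh.continuous _).comp (hθc p),
    fun p => (hh.injective _).comp (hθi p), fun p => ?_, fun p p' hpp' => ?_, ?_⟩, hUnion⟩
  · rw [himage]
    exact isOpen_image_of_subset_Ioo (hh.continuous _) (hh.injective _) (hh.isOpen _)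
      isOpen_Ioo (hsub p)
  · rw [himage, himage]
    rcases eq_or_ne p.1 p'.1 with hw | hw
    · obtain ⟨w, b⟩ := p
      obtain ⟨w', b'⟩ := p'
      obtain rfl : w = w' := hw
      rw [disjoint_image_iff (hh.injective w), disjoint_left]
      have hbb' : b ≠ b' := fun h => hpp' (Prod.ext rfl h)
      cases b <;> cases b' <;> grind
    · exact (hh.disjoint _ _ hw).mono (image_mono (hsub p)) (image_mono (hsub p'))
  · rw [hUnion, Set.compl_sdiff]
    exact (countable_range _).union hh.countable_compl

theorem IsArcFamily.exists_notMem [T2Space G] [Countable ι] {h : ι → unitInterval → G}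
    (hh : IsArcFamily h) (x : G) : ∃ h' : ι × Bool → unitInterval → G, IsArcFamily h' ∧
      ⋃ w, h' w '' Ioo 0 1 ⊆ (⋃ w, h w '' Ioo 0 1) \ {x} := by
  have : ∀ w, ∃ t ∈ Ioo (0 : unitInterval) 1, x ∈ h w '' Ioo 0 1 → h w t = x := fun w => by
    by_cases hx : x ∈ h w '' Ioo 0 1
    · obtain ⟨t, ht, hxt⟩ := hx
      exact ⟨t, ht, fun _ => hxt⟩
    · obtain ⟨t, ht⟩ := exists_between (zero_lt_one : (0 : unitInterval) < 1)
      exact ⟨t, ht, fun hx' => (hx hx').elim⟩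
  choose t ht hxt using this
  obtain ⟨h', hh', hUnion⟩ := hh.exists_split ht
  refine ⟨h', hh', hUnion.subset.trans fun z ⟨hz, hzt⟩ => ⟨hz, ?_⟩⟩
  rintro rfl
  obtain ⟨w, hw⟩ := mem_iUnion.1 hz
  exact hzt ⟨w, hxt w hw⟩

theorem IsArcFamily.exists_isArcBetween {G : Type*} [MetricSpace G] [Countable ι]
    {h : ι → unitInterval → G} (hh : IsArcFamily h) {K : Set G} (hc : IsCompact K)
    (hK : IsPreconnected K) {x y : G} (hx : x ∈ K) (hy : y ∈ K) (hxy : x ≠ y) :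
    ∃ γ ⊆ K, IsArcBetween x y γ := by
  obtain ⟨h₁, hh₁, hsub₁⟩ := hh.exists_notMem x
  obtain ⟨h₂, hh₂, hsub₂⟩ := hh₁.exists_notMem y
  refine hh₂.exists_isArcBetween_of_notMem (fun w hw => ?_) (fun w hw => ?_) hc hK hx hy hxy
  · exact (hsub₁ (hsub₂ (mem_iUnion_of_mem w hw)).1).2 rfl
  · exact (hsub₂ (mem_iUnion_of_mem w hw)).2 rfl

end ArcFamily

section Paths

variable {ι : Type*} {R : ι → ι → Prop} {s : ℕ → ι} {n : ℕ}

/-- The first `n` steps of the sequence `s` are related by `R`. -/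
def IsPathUpTo (R : ι → ι → Prop) (s : ℕ → ι) (n : ℕ) : Prop := ∀ k < n, R (s k) (s (k + 1))

/-- The infinite paths of a relation, seen as a directed graph. -/
def paths (R : ι → ι → Prop) : Set (ℕ → ι) := {s | ∀ k, R (s k) (s (k + 1))}

/-- A relation is mixing if any two states are joined by paths of every large enough length. -/
def IsMixingRel (R : ι → ι → Prop) : Prop :=
  ∀ i j, ∀ᶠ n in atTop, ∃ s : ℕ → ι, s 0 = i ∧ s n = j ∧ IsPathUpTo R s n

theorem IsPathUpTo.mono {m : ℕ} (hs : IsPathUpTo R s n) (hmn : m ≤ n) : IsPathUpTo R s m :=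
  fun k hk => hs k (hk.trans_le hmn)

theorem isPathUpTo_of_mem_paths (hs : s ∈ paths R) (n : ℕ) : IsPathUpTo R s n :=
  fun k _ => hs k

theorem IsPathUpTo.reflTransGen (hs : IsPathUpTo R s n) : Relation.ReflTransGen R (s 0) (s n) := by
  induction n with
  | zero => exact .refl
  | succ n ih => exact (ih (hs.mono n.le_succ)).tail (hs n n.lt_succ_self)

theorem IsMixingRel.reflTransGen (hR : IsMixingRel R) (i j : ι) : Relation.ReflTransGen R i j := by
  obtain ⟨n, s, rfl, rfl, hs⟩ := (hR i j).exists
  exact hs.reflTransGen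

theorem IsMixingRel.exists_rel (hR : IsMixingRel R) (i : ι) : ∃ j, R i j := by
  obtain ⟨n, ⟨s, rfl, -, hs⟩, hn⟩ := ((hR i i).and (eventually_gt_atTop 0)).exists
  exact ⟨_, hs 0 hn⟩

theorem IsMixingRel.exists_mem_paths (hR : IsMixingRel R) (i : ι) : ∃ s ∈ paths R, s 0 = i := by
  choose next hnext using hR.exists_rel
  refine ⟨fun k => next^[k] i, fun k => ?_, rfl⟩
  simpa only [Function.iterate_succ_apply'] using hnext (next^[k] i)

/-- Otherwise `t` is the only path starting at `t 0`, so that for large `n` both elements of a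
nontrivial pair would have to be `t n`. -/
theorem IsMixingRel.exists_rel_ne [Nontrivial ι] (hR : IsMixingRel R) (t : ℕ → ι) :
    ∃ k j, R (t k) j ∧ j ≠ t (k + 1) := by
  by_contra! hforced
  have huniq : ∀ {n} {s : ℕ → ι}, s 0 = t 0 → IsPathUpTo R s n → s n = t n := by
    intro n s h0 hs
    induction n with
    | zero => exact h0
    | succ n ih => exact hforced n _ (ih (hs.mono n.le_succ) ▸ hs n n.lt_succ_self)
  obtain ⟨i, j, hij⟩ := exists_pair_ne ι
  obtain ⟨n, ⟨s, hs0, hsi, hs⟩, s', hs0', hsj, hs'⟩ := ((hR (t 0) i).and (hR (t 0) j)).exists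
  exact hij (by rw [← hsi, ← hsj, huniq hs0 hs, huniq hs0' hs'])

/-- A path that returns to `i` follows the forced steps after `i` up to the first branching
state. -/
theorem IsMixingRel.exists_frequently_eq_branching [Nontrivial ι] (hR : IsMixingRel R)
    (hs : s ∈ paths R) {i : ι} (hi : ∃ᶠ n in atTop, s n = i) :
    ∃ b j j', R b j ∧ R b j' ∧ j ≠ j' ∧ ∃ᶠ n in atTop, s n = b := by
  classical
  obtain ⟨t, ht, ht0⟩ := hR.exists_mem_paths i
  have hbranch := hR.exists_rel_ne t
  let K := Nat.find hbranch
  obtain ⟨j, hj, hne⟩ := Nat.find_spec hbranch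
  have hforced : ∀ k < K, ∀ j, R (t k) j → j = t (k + 1) := fun k hk j hj => by
    by_contra hne
    exact Nat.find_min hbranch hk ⟨j, hj, hne⟩
  have hfollow : ∀ n, s n = i → s (n + K) = t K := by
    intro n hn
    suffices ∀ k ≤ K, s (n + k) = t k from this K le_rfl
    intro k hk
    induction k with
    | zero => exact hn.trans ht0.symm
    | succ k ih => exact hforced k hk _ (ih (Nat.le_of_succ_le hk) ▸ hs (n + k))
  exact ⟨t K, j, t (K + 1), hj, ht K, hne,
    (tendsto_add_atTop_nat K).frequently (hi.mono hfollow)⟩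

end Paths

section Subeigenvectors

variable {ι : Type*} {R : ι → ι → Prop} {lam : ℝ} {v : ι → ℝ}

open Classical in
/-- The 0-1 matrix of a relation. -/
noncomputable def adjacency (R : ι → ι → Prop) (i j : ι) : ℝ := if R i j then 1 else 0

/-- The expansion rate `(M v)_i / v_i` of the vector `v` at `i`, for the 0-1 matrix `M` of `R`. -/
noncomputable def expansionRate (R : ι → ι → Prop) (v : ι → ℝ) (i : ι) : ℝ :=
  (∑' j, adjacency R i j * v j) / v i

/-- The weight `v_{iₙ} / (λ_{i₀} ⋯ λ_{iₙ₋₁})` of the first `n + 1` letters of a sequence. -/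
noncomputable def pathWeight (R : ι → ι → Prop) (v : ι → ℝ) (s : ℕ → ι) (n : ℕ) : ℝ :=
  v (s n) / ∏ k ∈ Finset.range n, expansionRate R v (s k)

/-- The transition probabilities `m_{ij} v_j / (λ_i v_i)` of the Markov chain that a subeigenvector
`v` puts on the paths of `R`. -/
noncomputable def transitionProb (R : ι → ι → Prop) (v : ι → ℝ) (i j : ι) : ℝ :=
  adjacency R i j * v j / (expansionRate R v i * v i)

/-- A nonnegative `lam`-subeigenvector of total mass one whose expansion rates differ from `lam`
at finitely many states only. -/
structure IsNormalizedSubeigenvector (R : ι → ι → Prop) (lam : ℝ) (v : ι → ℝ) : Prop where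
  one_lt : 1 < lam
  nonneg : ∀ i, 0 ≤ v i
  hasSum : HasSum v 1
  summable : ∀ i, Summable fun j => adjacency R i j * v j
  le : ∀ i, ∑' j, adjacency R i j * v j ≤ lam * v i
  finite : {i | expansionRate R v i < lam}.Finite

theorem adjacency_of_rel {i j : ι} (hij : R i j) : adjacency R i j = 1 := if_pos hij

theorem adjacency_of_not_rel {i j : ι} (hij : ¬ R i j) : adjacency R i j = 0 := if_neg hij

theorem adjacency_nonneg (R : ι → ι → Prop) (i j : ι) : 0 ≤ adjacency R i j := by
  unfold adjacency
  split_ifs <;> norm_num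

namespace IsNormalizedSubeigenvector

theorem le_one (hv : IsNormalizedSubeigenvector R lam v) (i : ι) : v i ≤ 1 :=
  le_hasSum hv.hasSum i fun j _ => hv.nonneg j

theorem le_tsum_of_rel (hv : IsNormalizedSubeigenvector R lam v) {i j : ι} (hij : R i j) :
    v j ≤ ∑' k, adjacency R i k * v k := by
  simpa only [adjacency_of_rel hij, one_mul] using
    (hv.summable i).le_tsum j fun k _ => mul_nonneg (adjacency_nonneg R i k) (hv.nonneg k)

theorem exists_pos (hv : IsNormalizedSubeigenvector R lam v) : ∃ i, 0 < v i := by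
  by_contra! hle
  have hzero : v = 0 := funext fun i => (hle i).antisymm (hv.nonneg i)
  exact zero_ne_one (hasSum_zero.unique (hzero ▸ hv.hasSum))

theorem pos (hv : IsNormalizedSubeigenvector R lam v) (hR : IsMixingRel R) (i : ι) : 0 < v i := by
  obtain ⟨j, hj⟩ := hv.exists_pos
  induction hR.reflTransGen i j using Relation.ReflTransGen.head_induction_on with
  | refl => exact hj
  | head hik _ ih =>
    exact pos_of_mul_pos_right (ih.trans_le ((hv.le_tsum_of_rel hik).trans (hv.le _)))
      (zero_lt_one.trans hv.one_lt).le

theorem expansionRate_mul (hv : IsNormalizedSubeigenvector R lam v) (hR : IsMixingRel R) (i : ι) :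
    expansionRate R v i * v i = ∑' j, adjacency R i j * v j :=
  div_mul_cancel₀ _ (hv.pos hR i).ne'

theorem expansionRate_pos (hv : IsNormalizedSubeigenvector R lam v) (hR : IsMixingRel R) (i : ι) :
    0 < expansionRate R v i := by
  obtain ⟨j, hij⟩ := hR.exists_rel i
  exact div_pos ((hv.pos hR j).trans_le (hv.le_tsum_of_rel hij)) (hv.pos hR i)

theorem expansionRate_le (hv : IsNormalizedSubeigenvector R lam v) (hR : IsMixingRel R) (i : ι) :
    expansionRate R v i ≤ lam :=
  (div_le_iff₀ (hv.pos hR i)).2 (hv.le i)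

theorem expansionRate_mul_pos (hv : IsNormalizedSubeigenvector R lam v) (hR : IsMixingRel R)
    (i : ι) : 0 < expansionRate R v i * v i :=
  mul_pos (hv.expansionRate_pos hR i) (hv.pos hR i)

theorem prod_expansionRate_pos (hv : IsNormalizedSubeigenvector R lam v) (hR : IsMixingRel R)
    (s : ℕ → ι) (n : ℕ) : 0 < ∏ k ∈ Finset.range n, expansionRate R v (s k) :=
  Finset.prod_pos fun _ _ => hv.expansionRate_pos hR _

theorem pathWeight_pos (hv : IsNormalizedSubeigenvector R lam v) (hR : IsMixingRel R)
    (s : ℕ → ι) (n : ℕ) : 0 < pathWeight R v s n :=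
  div_pos (hv.pos hR _) (hv.prod_expansionRate_pos hR s n)

theorem transitionProb_nonneg (hv : IsNormalizedSubeigenvector R lam v) (hR : IsMixingRel R)
    (i j : ι) : 0 ≤ transitionProb R v i j :=
  div_nonneg (mul_nonneg (adjacency_nonneg R i j) (hv.nonneg j)) (hv.expansionRate_mul_pos hR i).le

theorem transitionProb_pos (hv : IsNormalizedSubeigenvector R lam v) (hR : IsMixingRel R)
    {i j : ι} (hij : R i j) : 0 < transitionProb R v i j := by
  rw [transitionProb, adjacency_of_rel hij, one_mul]
  exact div_pos (hv.pos hR j) (hv.expansionRate_mul_pos hR i)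

theorem hasSum_transitionProb (hv : IsNormalizedSubeigenvector R lam v) (hR : IsMixingRel R)
    (i : ι) : HasSum (transitionProb R v i) 1 := by
  have hdiv := (hv.summable i).hasSum.div_const (expansionRate R v i * v i)
  rwa [← hv.expansionRate_mul hR i, div_self (hv.expansionRate_mul_pos hR i).ne'] at hdiv

theorem transitionProb_le_one (hv : IsNormalizedSubeigenvector R lam v) (hR : IsMixingRel R)
    (i j : ι) : transitionProb R v i j ≤ 1 :=
  le_hasSum (hv.hasSum_transitionProb hR i) j fun k _ => hv.transitionProb_nonneg hR i k

theorem transitionProb_add_le_one (hv : IsNormalizedSubeigenvector R lam v) (hR : IsMixingRel R)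
    {i j k : ι} (hjk : j ≠ k) : transitionProb R v i j + transitionProb R v i k ≤ 1 := by
  classical
  rw [← Finset.sum_pair hjk]
  exact sum_le_hasSum _ (fun l _ => hv.transitionProb_nonneg hR i l) (hv.hasSum_transitionProb hR i)

theorem exists_transitionProb_le (hv : IsNormalizedSubeigenvector R lam v) (hR : IsMixingRel R)
    {i j j' : ι} (hj : R i j) (hj' : R i j') (hne : j ≠ j') :
    ∃ c < 1, ∀ k, transitionProb R v i k ≤ c := by
  refine ⟨max (1 - transitionProb R v i j) (1 - transitionProb R v i j'),
    max_lt ?_ ?_, fun k => ?_⟩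
  · linarith [hv.transitionProb_pos hR hj]
  · linarith [hv.transitionProb_pos hR hj']
  · obtain rfl | hk := eq_or_ne k j
    · exact le_max_of_le_right (le_sub_right_of_add_le (hv.transitionProb_add_le_one hR hne))
    · exact le_max_of_le_left (le_sub_right_of_add_le (hv.transitionProb_add_le_one hR hk))

theorem pathWeight_succ (hv : IsNormalizedSubeigenvector R lam v) (hR : IsMixingRel R)
    {s : ℕ → ι} {n : ℕ} (hs : R (s n) (s (n + 1))) :
    pathWeight R v s (n + 1) = pathWeight R v s n * transitionProb R v (s n) (s (n + 1)) := by
  have hvn := (hv.pos hR (s n)).ne'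
  have hrate := (hv.expansionRate_pos hR (s n)).ne'
  have hprod := (hv.prod_expansionRate_pos hR s n).ne'
  rw [pathWeight, pathWeight, transitionProb, adjacency_of_rel hs, Finset.prod_range_succ]
  field_simp

theorem mul_prod_transitionProb (hv : IsNormalizedSubeigenvector R lam v) (hR : IsMixingRel R)
    {s : ℕ → ι} {n : ℕ} (hs : IsPathUpTo R s n) :
    v (s 0) * ∏ k ∈ Finset.range n, transitionProb R v (s k) (s (k + 1)) = pathWeight R v s n := by
  induction n with
  | zero => simp [pathWeight]
  | succ n ih =>
    rw [Finset.prod_range_succ, ← mul_assoc, ih (hs.mono n.le_succ),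
      hv.pathWeight_succ hR (hs n n.lt_succ_self)]

theorem antitone_pathWeight (hv : IsNormalizedSubeigenvector R lam v) (hR : IsMixingRel R)
    {s : ℕ → ι} (hs : s ∈ paths R) : Antitone (pathWeight R v s) :=
  antitone_nat_of_succ_le fun n => by
    rw [hv.pathWeight_succ hR (hs n)]
    exact mul_le_of_le_one_right (hv.pathWeight_pos hR s n).le (hv.transitionProb_le_one hR _ _)

end IsNormalizedSubeigenvector

theorem tendsto_zero_of_antitone_of_frequently_le_mul {u : ℕ → ℝ} (hu : Antitone u)
    (hu0 : ∀ n, 0 ≤ u n) {c : ℝ} (hc : c < 1) (hfreq : ∃ᶠ n in atTop, u (n + 1) ≤ u n * c) :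
    Tendsto u atTop (𝓝 0) := by
  have hbdd : BddBelow (range u) := ⟨0, forall_mem_range.2 hu0⟩
  have hlim := tendsto_atTop_ciInf hu hbdd
  have hle : ⨅ n, u n ≤ (⨅ n, u n) * c :=
    le_of_tendsto_of_tendsto_of_frequently ((tendsto_add_atTop_iff_nat 1).2 hlim)
      (hlim.mul_const c) hfreq
  have hnonneg : 0 ≤ ⨅ n, u n := le_ciInf hu0
  rwa [show ⨅ n, u n = 0 by nlinarith] at hlim

namespace IsNormalizedSubeigenvector

theorem tendsto_pathWeight_of_frequently_eq [Nontrivial ι]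
    (hv : IsNormalizedSubeigenvector R lam v) (hR : IsMixingRel R) {s : ℕ → ι} (hs : s ∈ paths R)
    {i : ι} (hi : ∃ᶠ n in atTop, s n = i) : Tendsto (pathWeight R v s) atTop (𝓝 0) := by
  obtain ⟨b, j, j', hj, hj', hne, hb⟩ := hR.exists_frequently_eq_branching hs hi
  obtain ⟨c, hc, hle⟩ := hv.exists_transitionProb_le hR hj hj' hne
  refine tendsto_zero_of_antitone_of_frequently_le_mul (hv.antitone_pathWeight hR hs)
    (fun n => (hv.pathWeight_pos hR s n).le) hc (hb.mono fun n hn => ?_)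
  rw [hv.pathWeight_succ hR (hs n), hn]
  exact mul_le_mul_of_nonneg_left (hle _) (hv.pathWeight_pos hR s n).le

theorem tendsto_pathWeight_of_eventually_expansionRate_eq
    (hv : IsNormalizedSubeigenvector R lam v) (hR : IsMixingRel R) {s : ℕ → ι}
    (hs : ∀ᶠ n in atTop, expansionRate R v (s n) = lam) :
    Tendsto (pathWeight R v s) atTop (𝓝 0) := by
  obtain ⟨N, hN⟩ := eventually_atTop.1 hs
  let C := ∏ k ∈ Finset.range N, expansionRate R v (s k)
  have hC : 0 < C := hv.prod_expansionRate_pos hR s N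
  have hprod : ∀ m, ∏ k ∈ Finset.range (m + N), expansionRate R v (s k) = C * lam ^ m := by
    intro m
    rw [add_comm, Finset.prod_range_add, Finset.prod_congr rfl fun k _ => hN (N + k) (by omega),
      Finset.prod_const, Finset.card_range]
  have hpow : Tendsto (fun m => C * lam ^ m) atTop atTop :=
    (tendsto_pow_atTop_atTop_of_one_lt hv.one_lt).const_mul_atTop hC
  rw [← tendsto_add_atTop_iff_nat N]
  refine squeeze_zero (fun m => (hv.pathWeight_pos hR s _).le) (fun m => ?_)
    hpow.inv_tendsto_atTop
  rw [pathWeight, hprod, Pi.inv_apply, ← one_div]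
  have hlam : 0 < lam := zero_lt_one.trans hv.one_lt
  exact div_le_div_of_nonneg_right (hv.le_one _) (mul_pos hC (pow_pos hlam m)).le

theorem tendsto_pathWeight [Nontrivial ι] (hv : IsNormalizedSubeigenvector R lam v)
    (hR : IsMixingRel R) {s : ℕ → ι} (hs : s ∈ paths R) :
    Tendsto (pathWeight R v s) atTop (𝓝 0) := by
  by_cases hrec : ∃ i, ∃ᶠ n in atTop, s n = i
  · obtain ⟨i, hi⟩ := hrec
    exact hv.tendsto_pathWeight_of_frequently_eq hR hs hi
  · push Not at hrec
    refine hv.tendsto_pathWeight_of_eventually_expansionRate_eq hR ?_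
    filter_upwards [(eventually_all_finite hv.finite).2 fun i _ => hrec i] with n hn
    exact (hv.expansionRate_le hR _).eq_of_not_lt fun hlt => hn _ hlt rfl

end IsNormalizedSubeigenvector

end Subeigenvectors

section PathMeasure

open MeasureTheory

variable {ι : Type*} {R : ι → ι → Prop} {lam : ℝ} {v : ι → ℝ}

/-- The word formed by the first `n + 1` letters of a sequence. -/
def initialWord (n : ℕ) (s : ℕ → ι) : Fin (n + 1) → ι := fun k => s k

theorem initialWord_eq_iff {n : ℕ} {s t : ℕ → ι} :
    initialWord n s = initialWord n t ↔ ∀ k ≤ n, s k = t k := by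
  simp only [initialWord, funext_iff, Fin.forall_iff, Nat.lt_succ_iff]

theorem initialWord_surjective [Nonempty ι] (n : ℕ) :
    Function.Surjective (initialWord n : (ℕ → ι) → Fin (n + 1) → ι) :=
  Fin.val_injective.surjective_comp_right

variable [MeasurableSpace ι]

/-- A probability measure carried by the infinite paths of `R` that gives to each finite path its
weight. -/
structure IsPathMeasure (R : ι → ι → Prop) (v : ι → ℝ) (μ : Measure (ℕ → ι)) : Prop where
  isProbabilityMeasure : IsProbabilityMeasure μ
  measure_word : ∀ n s, IsPathUpTo R s n →
    μ (initialWord n ⁻¹' {initialWord n s}) = ENNReal.ofReal (pathWeight R v s n)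
  ae_mem_paths : ∀ᵐ s ∂μ, s ∈ paths R

theorem measurable_initialWord (n : ℕ) :
    Measurable (initialWord n : (ℕ → ι) → Fin (n + 1) → ι) :=
  measurable_pi_lambda _ fun k => measurable_pi_apply (k : ℕ)

theorem IsPathMeasure.nullSingletonClass [Nontrivial ι] {μ : Measure (ℕ → ι)}
    (hμ : IsPathMeasure R v μ) (hv : IsNormalizedSubeigenvector R lam v) (hR : IsMixingRel R) :
    NullSingletonClass μ := by
  refine ⟨fun s => ?_⟩
  by_cases hs : s ∈ paths R
  · have hlim : Tendsto (fun n => ENNReal.ofReal (pathWeight R v s n)) atTop (𝓝 0) := by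
      simpa using ENNReal.tendsto_ofReal (hv.tendsto_pathWeight hR hs)
    refine le_antisymm (ge_of_tendsto' hlim fun n => ?_) zero_le
    rw [← hμ.measure_word n s (isPathUpTo_of_mem_paths hs n)]
    exact measure_mono (singleton_subset_iff.2 rfl)
  · exact measure_mono_null (singleton_subset_iff.2 hs) hμ.ae_mem_paths

variable [Countable ι] [MeasurableSingletonClass ι]

theorem measurableSet_of_forall_initialWord_eq {n : ℕ} {S : Set (ℕ → ι)}
    (hS : ∀ s t, initialWord n s = initialWord n t → s ∈ S → t ∈ S) : MeasurableSet S := by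
  have hpre : S = initialWord n ⁻¹' (initialWord n '' S) :=
    (subset_preimage_image _ _).antisymm fun t ⟨s, hs, hst⟩ => hS s t hst hs
  rw [hpre]
  exact measurable_initialWord n (Set.to_countable _).measurableSet

theorem measurableSet_paths (R : ι → ι → Prop) : MeasurableSet (paths R) := by
  rw [paths, ofPred_forall]
  refine MeasurableSet.iInter fun k => measurableSet_of_forall_initialWord_eq (n := k + 1)
    fun s t hst hs => ?_
  rw [initialWord_eq_iff] at hst
  rwa [mem_ofPred_eq, ← hst k k.le_succ, ← hst (k + 1) le_rfl]

theorem hasSum_ofReal_one {κ : Type*} {p : κ → ℝ} (hp : ∀ i, 0 ≤ p i) (hsum : HasSum p 1) :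
    HasSum (fun i => ENNReal.ofReal (p i)) 1 := by
  rw [ENNReal.summable.hasSum_iff, ← ENNReal.ofReal_tsum_of_nonneg hp hsum.summable, hsum.tsum_eq,
    ENNReal.ofReal_one]

theorem IsNormalizedSubeigenvector.exists_isPathMeasure (hv : IsNormalizedSubeigenvector R lam v)
    (hR : IsMixingRel R) : ∃ μ : Measure (ℕ → ι), IsPathMeasure R v μ := by
  let q₀ : PMF ι := ⟨fun i => ENNReal.ofReal (v i), hasSum_ofReal_one hv.nonneg hv.hasSum⟩
  let q : ι → PMF ι := fun i => ⟨fun j => ENNReal.ofReal (transitionProb R v i j),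
    hasSum_ofReal_one (hv.transitionProb_nonneg hR i) (hv.hasSum_transitionProb hR i)⟩
  have hword : ∀ n s, markovMeasure q₀ q (initialWord n ⁻¹' {initialWord n s}) =
      ENNReal.ofReal (v (s 0) * ∏ k ∈ Finset.range n, transitionProb R v (s k) (s (k + 1))) := by
    intro n s
    rw [ENNReal.ofReal_mul (hv.nonneg _),
      ENNReal.ofReal_prod_of_nonneg fun k _ => hv.transitionProb_nonneg hR _ _,
      show initialWord n ⁻¹' {initialWord n s} = {ω | ∀ k ≤ n, ω k = s k} from
        ext fun ω => initialWord_eq_iff, markovMeasure_setOf_forall_le_eq]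
    rfl
  refine ⟨markovMeasure q₀ q, inferInstance,
    fun n s hs => by rw [hword, hv.mul_prod_transitionProb hR hs], ae_all_iff.2 fun n => ?_⟩
  have : Nonempty ι := hv.exists_pos.nonempty
  suffices hcover : {ω : ℕ → ι | ¬ R (ω n) (ω (n + 1))} ⊆
      ⋃ w ∈ initialWord (n + 1) '' {s | ¬ R (s n) (s (n + 1))}, initialWord (n + 1) ⁻¹' {w} by
    refine measure_mono_null hcover ((measure_biUnion_null_iff (to_countable _)).2 ?_)
    rintro _ ⟨s, hs, rfl⟩
    rw [hword, Finset.prod_range_succ, transitionProb, adjacency_of_not_rel hs]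
    simp
  exact fun ω hω => mem_biUnion (mem_image_of_mem _ hω) rfl

end PathMeasure

section MarkovFamilies

variable {G : Type*} {ι : Type*}

/-- A Markov partition of the mixing map `f`, given by parametrizations of its arcs. -/
structure IsMarkovFamily [TopologicalSpace G] (f : G → G) (h : ι → unitInterval → G) : Prop
    extends IsArcFamily h where
  continuous_map : Continuous f
  injOn : ∀ i, InjOn f (range (h i))
  markov : ∀ i j, (f '' range (h i) ∩ h j '' Ioo 0 1).Nonempty → range (h j) ⊆ f '' range (h i)
  mixing : IsTopMixing f

/-- The transition relation of a parametrized Markov partition: the image of the arc `i` contains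
the arc `j`. -/
def Covers (f : G → G) (h : ι → unitInterval → G) (i j : ι) : Prop :=
  range (h j) ⊆ f '' range (h i)

/-- The points in the interior of no partition arc, written `P` in the paper. -/
def exceptional (h : ι → unitInterval → G) : Set G := (⋃ i, h i '' Ioo 0 1)ᶜ

theorem notMem_exceptional {h : ι → unitInterval → G} {p : G} :
    p ∉ exceptional h ↔ ∃ i, p ∈ h i '' Ioo 0 1 := by
  rw [exceptional, notMem_compl_iff, mem_iUnion]

namespace IsArcFamily

variable [TopologicalSpace G] {h : ι → unitInterval → G}

theorem countable_exceptional (hh : IsArcFamily h) : (exceptional h).Countable :=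
  hh.countable_compl

theorem dense_compl_exceptional [T1Space G] [BaireSpace G] [ConnectedSpace G] [Nontrivial G]
    (hh : IsArcFamily h) : Dense (exceptional h)ᶜ :=
  dense_compl_of_countable hh.countable_exceptional

theorem eq_of_mem (hh : IsArcFamily h) {i j : ι} {p : G} (hi : p ∈ h i '' Ioo 0 1)
    (hj : p ∈ h j '' Ioo 0 1) : i = j := by
  by_contra hne
  exact disjoint_left.1 (hh.disjoint i j hne) hi hj

theorem eq_of_mem_range [T2Space G] (hh : IsArcFamily h) {i j : ι} {p : G}
    (hi : p ∈ range (h i)) (hj : p ∈ h j '' Ioo 0 1) : i = j := by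
  rw [← closure_image_Ioo (hh.continuous i)] at hi
  obtain ⟨q, hqj, hqi⟩ := mem_closure_iff.1 hi _ (hh.isOpen j) hj
  exact hh.eq_of_mem hqi hqj

theorem mem_image_Ioo [T2Space G] (hh : IsArcFamily h) {i : ι} {p : G} (hi : p ∈ range (h i))
    (hp : p ∉ exceptional h) : p ∈ h i '' Ioo 0 1 := by
  obtain ⟨j, hj⟩ := notMem_exceptional.1 hp
  rwa [hh.eq_of_mem_range hi hj]

theorem mem_exceptional_of_mapClusterPt [T2Space G] (hh : IsArcFamily h) {κ : Type*}
    {l : Filter κ} {e : κ → ι} (he : Tendsto e l cofinite) {z : κ → G}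
    (hz : ∀ᶠ n in l, z n ∈ range (h (e n))) {c : G} (hc : MapClusterPt c l z) :
    c ∈ exceptional h := by
  by_contra hcQ
  obtain ⟨i, hi⟩ := notMem_exceptional.1 hcQ
  have hzi : ∃ᶠ n in l, z n ∈ h i '' Ioo 0 1 := hc.frequently ((hh.isOpen i).mem_nhds hi)
  have hei : ∀ᶠ n in l, e n ≠ i := he.eventually (eventually_cofinite_ne i)
  obtain ⟨n, hn, hne, hnz⟩ := (hzi.and_eventually (hei.and hz)).exists
  exact hne (hh.eq_of_mem_range hnz hn)

end IsArcFamily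

/-- If `a ≠ b`, each sphere around `a` of radius less than `dist b a` meets almost all of the arcs,
hence contains a cluster point of them. But the cluster points are countably many. -/
theorem IsArcFamily.eq_of_tendsto [MetricSpace G] [CompactSpace G] {h : ι → unitInterval → G}
    (hh : IsArcFamily h) {κ : Type*} {l : Filter κ} [NeBot l] {e : κ → ι}
    (he : Tendsto e l cofinite) {p q : κ → G} (hp : ∀ n, p n ∈ range (h (e n)))
    (hq : ∀ n, q n ∈ range (h (e n))) {a b : G} (ha : Tendsto p l (𝓝 a))
    (hb : Tendsto q l (𝓝 b)) : a = b := by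
  by_contra hab
  have hradii : Dense ((dist · a) '' exceptional h)ᶜ :=
    (hh.countable_exceptional.image _).dense_compl ℝ
  obtain ⟨r, hr, hr0, hrb⟩ := hradii.exists_between (dist_pos.2 (Ne.symm hab))
  have hsphere : ∀ᶠ n in l, ∃ z, z ∈ range (h (e n)) ∧ dist z a = r := by
    have hpr : ∀ᶠ n in l, dist (p n) a < r :=
      (ha.dist tendsto_const_nhds).eventually_lt_const (by rwa [dist_self])
    have hqr : ∀ᶠ n in l, r < dist (q n) a :=
      (hb.dist tendsto_const_nhds).eventually_const_lt hrb
    filter_upwards [hpr, hqr] with n hpn hqn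
    exact (isPreconnected_range (hh.continuous _)).intermediate_value (hp n) (hq n)
      (continuous_id.dist continuous_const).continuousOn (f := (dist · a)) ⟨hpn.le, hqn.le⟩
  obtain ⟨z, hz⟩ := hsphere.choice
  obtain ⟨c, hc⟩ : ∃ c, MapClusterPt c l z := exists_clusterPt_of_compactSpace _
  have hcr : c ∈ {z | dist z a = r} :=
    (isClosed_eq (continuous_id.dist continuous_const) continuous_const).mem_of_mapClusterPt hc
      (hz.mono fun _ hn => hn.2)
  exact hr ⟨c, hh.mem_exceptional_of_mapClusterPt he (hz.mono fun _ hn => hn.1) hc, hcr⟩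

theorem IsArcFamily.finite_covers [MetricSpace G] [CompactSpace G] {f : G → G}
    {h : ι → unitInterval → G} (hh : IsArcFamily h) (hf : Continuous f) (j : ι) :
    {i | Covers f h i j}.Finite := by
  by_contra hinf
  let κ := {i // Covers f h i j}
  have : Infinite κ := Set.infinite_coe_iff.2 hinf
  have lift_endpoint : ∀ t, ∃ p : κ → G, (∀ i, p i ∈ range (h i.1)) ∧
      ∃ a, Tendsto p (hyperfilter κ) (𝓝 a) ∧ f a = h j t := fun t => by
    choose p hp hfp using fun i : κ => i.2 (mem_range_self t)
    obtain ⟨a, -, ha⟩ := isCompact_univ.ultrafilter_le_nhds ((hyperfilter _).map p) (by simp)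
    refine ⟨p, hp, a, ha, tendsto_nhds_unique ((hf.tendsto a).comp ha) ?_⟩
    simp only [Function.comp_def, hfp, tendsto_const_nhds]
  obtain ⟨p, hp, a, ha, hfa⟩ := lift_endpoint 0
  obtain ⟨q, hq, b, hb, hfb⟩ := lift_endpoint 1
  have hcofinite : Tendsto Subtype.val (hyperfilter κ) cofinite :=
    (Subtype.val_injective (p := (Covers f h · j))).tendsto_cofinite.mono_left
      hyperfilter_le_cofinite
  obtain rfl := hh.eq_of_tendsto hcofinite hp hq ha hb
  exact zero_ne_one (hh.injective j (hfa.symm.trans hfb))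

namespace IsMarkovFamily

theorem injective_comp [TopologicalSpace G] {f : G → G} {h : ι → unitInterval → G}
    (hh : IsMarkovFamily f h) (i : ι) : Function.Injective (f ∘ h i) :=
  fun a b hab => hh.injective i (hh.injOn i (mem_range_self a) (mem_range_self b) hab)

variable [MetricSpace G] [CompactSpace G] [ConnectedSpace G] {f : G → G}
  {h : ι → unitInterval → G}

theorem exists_covers_mem_range (hh : IsMarkovFamily f h) {j : ι} {x : G}
    (hx : f x ∈ h j '' Ioo 0 1) : ∃ i, Covers f h i j ∧ x ∈ range (h i) := by
  have : Nontrivial G := (hh.injective j).nontrivial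
  have hopen : IsOpen (f ⁻¹' (h j '' Ioo 0 1)) := (hh.isOpen j).preimage hh.continuous_map
  have hclosed : IsClosed (⋃ i ∈ {i | Covers f h i j}, range (h i)) :=
    (hh.finite_covers hh.continuous_map j).isClosed_biUnion fun i _ =>
      (isCompact_range (hh.continuous i)).isClosed
  have hcover : f ⁻¹' (h j '' Ioo 0 1) ∩ (exceptional h)ᶜ ⊆
      ⋃ i ∈ {i | Covers f h i j}, range (h i) := by
    rintro z ⟨hzj, hzQ⟩
    obtain ⟨i, hi⟩ := notMem_exceptional.1 hzQ
    have hzi : z ∈ range (h i) := image_subset_range _ _ hi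
    exact mem_biUnion (hh.markov i j ⟨f z, ⟨z, hzi, rfl⟩, hzj⟩) hzi
  simpa only [mem_iUnion, exists_prop, mem_ofPred_eq] using
    closure_minimal hcover hclosed (hh.dense_compl_exceptional.open_subset_closure_inter hopen hx)

theorem map_mem_exceptional (hh : IsMarkovFamily f h) {x : G} (hx : x ∈ exceptional h) :
    f x ∈ exceptional h := by
  by_contra hfx
  obtain ⟨j, hj⟩ := notMem_exceptional.1 hfx
  obtain ⟨i, hij, hxi⟩ := hh.exists_covers_mem_range hj
  obtain ⟨r, hr, hrx⟩ := image_Ioo_subset_of_range_subset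
    (hh.continuous_map.comp (hh.continuous i)) (hh.injective_comp i) (hh.continuous j)
    (hh.injective j) (by rw [range_comp]; exact hij) hj
  exact notMem_exceptional.2 ⟨i, r, hr, hh.injOn i (mem_range_self r) hxi hrx⟩ hx

theorem iterate_mem_exceptional (hh : IsMarkovFamily f h) {x : G} {k n : ℕ} (hkn : k ≤ n)
    (hx : f^[k] x ∈ exceptional h) : f^[n] x ∈ exceptional h := by
  induction n, hkn using Nat.le_induction with
  | base => exact hx
  | succ n _ ih => rw [Function.iterate_succ_apply']; exact hh.map_mem_exceptional ih

end IsMarkovFamily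

theorem IsMarkovFamily.countable_preimage_iterate [TopologicalSpace G] [Countable ι] {f : G → G}
    {h : ι → unitInterval → G} (hh : IsMarkovFamily f h) {C : Set G} (hC : C.Countable) (n : ℕ) :
    (f^[n] ⁻¹' C).Countable := by
  induction n with
  | zero => exact hC
  | succ n ih =>
    have hcover : f^[n + 1] ⁻¹' C ⊆
        exceptional h ∪ ⋃ i, range (h i) ∩ f ⁻¹' (f^[n] ⁻¹' C) := by
      intro z hz
      by_cases hzQ : z ∈ exceptional h
      · exact Or.inl hzQ
      · obtain ⟨i, hi⟩ := notMem_exceptional.1 hzQ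
        exact Or.inr (mem_iUnion.2 ⟨i, image_subset_range _ _ hi, hz⟩)
    refine (hh.countable_exceptional.union (countable_iUnion fun i => ?_)).mono hcover
    exact MapsTo.countable_of_injOn (f := f) (fun z hz => hz.2)
      ((hh.injOn i).mono inter_subset_left) ih

end MarkovFamilies

section Cylinders

variable {G : Type*} {ι : Type*} {f : G → G} {h : ι → unitInterval → G} {s t : ℕ → ι} {n : ℕ}

/-- The cylinder `[s 0 ⋯ s n]` of the paper: the points that visit the arc `s k` at each time
`k ≤ n`. -/
def cyl (f : G → G) (h : ι → unitInterval → G) (s : ℕ → ι) (n : ℕ) : Set G :=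
  {p | ∀ k ≤ n, f^[k] p ∈ range (h (s k))}

/-- The points that visit the interior of the arc `s k` at each time `k ≤ n`. -/
def cylInt (f : G → G) (h : ι → unitInterval → G) (s : ℕ → ι) (n : ℕ) : Set G :=
  {p | ∀ k ≤ n, f^[k] p ∈ h (s k) '' Ioo 0 1}

theorem cyl_antitone (f : G → G) (h : ι → unitInterval → G) (s : ℕ → ι) : Antitone (cyl f h s) :=
  fun _ _ hmn _ hp k hk => hp k (hk.trans hmn)

theorem cyl_congr (f : G → G) (h : ι → unitInterval → G) (hst : ∀ k ≤ n, s k = t k) :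
    cyl f h s n = cyl f h t n :=
  ext fun _ => forall₂_congr fun k hk => by rw [hst k hk]

theorem cyl_zero (f : G → G) (h : ι → unitInterval → G) (s : ℕ → ι) :
    cyl f h s 0 = range (h (s 0)) :=
  ext fun p => by simp only [cyl, nonpos_iff_eq_zero, forall_eq, Function.iterate_zero, id,
    mem_ofPred_eq]

theorem cyl_subset_range (f : G → G) (h : ι → unitInterval → G) (s : ℕ → ι) (n : ℕ) :
    cyl f h s n ⊆ range (h (s 0)) :=
  fun _ hp => hp 0 n.zero_le

theorem cyl_succ (f : G → G) (h : ι → unitInterval → G) (s : ℕ → ι) (n : ℕ) :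
    cyl f h s (n + 1) = cyl f h s n ∩ f^[n + 1] ⁻¹' range (h (s (n + 1))) := by
  ext p
  simp only [cyl, Nat.le_succ_iff, or_imp, forall_and, forall_eq, mem_ofPred_eq, mem_inter_iff,
    mem_preimage]

theorem cylInt_subset_cyl : cylInt f h s n ⊆ cyl f h s n :=
  fun _ hp k hk => image_subset_range _ _ (hp k hk)

namespace IsMarkovFamily

section Topological

variable [TopologicalSpace G]

theorem isPathUpTo_of_mem_cylInt (hh : IsMarkovFamily f h) {p : G} (hp : p ∈ cylInt f h s n) :
    IsPathUpTo (Covers f h) s n := by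
  refine fun k hk => hh.markov _ _ ⟨f^[k + 1] p, ?_, hp (k + 1) hk⟩
  rw [Function.iterate_succ_apply']
  exact mem_image_of_mem f (cylInt_subset_cyl hp k hk.le)

theorem isOpen_cylInt (hh : IsMarkovFamily f h) (s : ℕ → ι) (n : ℕ) : IsOpen (cylInt f h s n) := by
  have hInter : cylInt f h s n = ⋂ k ∈ Iic n, f^[k] ⁻¹' (h (s k) '' Ioo 0 1) := by
    ext p
    simp only [cylInt, mem_ofPred_eq, mem_iInter, mem_preimage, mem_Iic]
  rw [hInter]
  exact (finite_Iic n).isOpen_biInter fun k _ =>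
    (hh.isOpen _).preimage (hh.continuous_map.iterate k)

theorem exists_param_cyl [T2Space G] (hh : IsMarkovFamily f h)
    (hs : IsPathUpTo (Covers f h) s n) :
    ∃ g : unitInterval → G, Continuous g ∧ Function.Injective g ∧ range g = cyl f h s n ∧
      ∀ r, f^[n] (g r) = h (s n) r := by
  induction n with
  | zero => exact ⟨h (s 0), hh.continuous _, hh.injective _, (cyl_zero f h s).symm, fun _ => rfl⟩
  | succ n ih =>
    obtain ⟨g, gc, -, gr, gf⟩ := ih (hs.mono n.le_succ)
    obtain ⟨θ, θc, hθ⟩ := exists_continuous_lift (hh.continuous_map.comp (hh.continuous (s n)))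
      (hh.injective_comp _) (hh.continuous (s (n + 1)))
      (by rw [range_comp]; exact hs n n.lt_succ_self)
    have hgθ : ∀ r, f^[n + 1] (g (θ r)) = h (s (n + 1)) r := fun r => by
      rw [Function.iterate_succ_apply', gf]
      exact hθ r
    have hinj : Function.Injective (g ∘ θ) := fun a b hab =>
      hh.injective (s (n + 1)) (by rw [← hgθ, ← hgθ]; exact congrArg _ hab)
    refine ⟨g ∘ θ, gc.comp θc, hinj, ?_, hgθ⟩
    rw [cyl_succ, ← gr]
    refine Subset.antisymm ?_ ?_
    · rintro _ ⟨r, rfl⟩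
      exact ⟨mem_range_self _, r, (hgθ r).symm⟩
    · rintro _ ⟨⟨a, rfl⟩, r, hr⟩
      rw [Function.iterate_succ_apply', gf, ← hθ r] at hr
      exact ⟨r, congrArg g (hh.injective_comp _ hr)⟩

theorem isCompact_cyl [T2Space G] (hh : IsMarkovFamily f h) (hs : IsPathUpTo (Covers f h) s n) :
    IsCompact (cyl f h s n) := by
  obtain ⟨g, gc, -, gr, -⟩ := hh.exists_param_cyl hs
  exact gr ▸ isCompact_range gc

theorem isPreconnected_cyl [T2Space G] (hh : IsMarkovFamily f h)
    (hs : IsPathUpTo (Covers f h) s n) : IsPreconnected (cyl f h s n) := by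
  obtain ⟨g, gc, -, gr, -⟩ := hh.exists_param_cyl hs
  exact gr ▸ isPreconnected_range gc

theorem nontrivial_cyl [T2Space G] (hh : IsMarkovFamily f h)
    (hs : IsPathUpTo (Covers f h) s n) : (cyl f h s n).Nontrivial := by
  obtain ⟨g, -, gi, gr, -⟩ := hh.exists_param_cyl hs
  exact gr ▸ ⟨g 0, mem_range_self 0, g 1, mem_range_self 1, gi.ne zero_ne_one⟩

end Topological

section Continuum

variable [MetricSpace G] [CompactSpace G] [ConnectedSpace G]

theorem mem_cylInt_iff (hh : IsMarkovFamily f h) {p : G} :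
    p ∈ cylInt f h s n ↔ p ∈ cyl f h s n ∧ f^[n] p ∉ exceptional h :=
  ⟨fun hp => ⟨cylInt_subset_cyl hp, notMem_exceptional.2 ⟨_, hp n le_rfl⟩⟩,
    fun ⟨hps, hp⟩ k hk => hh.mem_image_Ioo (hps k hk) fun hpk =>
      hp (hh.iterate_mem_exceptional hk hpk)⟩

theorem exists_mem_cylInt (hh : IsMarkovFamily f h) {p : G} (hp : f^[n] p ∉ exceptional h) :
    ∃ s : ℕ → ι, p ∈ cylInt f h s n := by
  have hvisit : ∀ k, ∃ i, k ≤ n → f^[k] p ∈ h i '' Ioo 0 1 := fun k => by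
    by_cases hk : k ≤ n
    · obtain ⟨i, hi⟩ := notMem_exceptional.1 fun hpk => hp (hh.iterate_mem_exceptional hk hpk)
      exact ⟨i, fun _ => hi⟩
    · obtain ⟨i, -⟩ := notMem_exceptional.1 hp
      exact ⟨i, fun hkn => (hk hkn).elim⟩
  choose s hs using hvisit
  exact ⟨s, hs⟩

theorem apply_eq_of_mem_cyl (hh : IsMarkovFamily f h) {p : G} (hs : p ∈ cyl f h s n)
    (ht : p ∈ cyl f h t n) (hp : f^[n] p ∉ exceptional h) {k : ℕ} (hk : k ≤ n) : s k = t k :=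
  hh.eq_of_mem (hh.mem_cylInt_iff.2 ⟨hs, hp⟩ k hk) (hh.mem_cylInt_iff.2 ⟨ht, hp⟩ k hk)

theorem exists_image_Ioo_eq_cylInt (hh : IsMarkovFamily f h)
    (hs : IsPathUpTo (Covers f h) s n) :
    ∃ g : unitInterval → G, Continuous g ∧ Function.Injective g ∧ range g = cyl f h s n ∧
      g '' Ioo 0 1 = cylInt f h s n := by
  obtain ⟨g, gc, gi, gr, gf⟩ := hh.exists_param_cyl hs
  refine ⟨g, gc, gi, gr, Subset.antisymm ?_ fun p hp => ?_⟩
  · rintro _ ⟨r, hr, rfl⟩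
    exact hh.mem_cylInt_iff.2
      ⟨gr ▸ mem_range_self r, notMem_exceptional.2 ⟨s n, r, hr, (gf r).symm⟩⟩
  · obtain ⟨r, rfl⟩ := gr ▸ cylInt_subset_cyl hp
    obtain ⟨r', hr', hrr'⟩ := hp n le_rfl
    rw [gf] at hrr'
    exact ⟨r, hh.injective _ hrr' ▸ hr', rfl⟩

theorem closure_cylInt (hh : IsMarkovFamily f h) (hs : IsPathUpTo (Covers f h) s n) :
    closure (cylInt f h s n) = cyl f h s n := by
  obtain ⟨g, gc, -, gr, gI⟩ := hh.exists_image_Ioo_eq_cylInt hs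
  rw [← gI, ← gr, closure_image_Ioo gc]

theorem isPreconnected_cylInt (hh : IsMarkovFamily f h) (hs : IsPathUpTo (Covers f h) s n) :
    IsPreconnected (cylInt f h s n) := by
  obtain ⟨g, gc, -, -, gI⟩ := hh.exists_image_Ioo_eq_cylInt hs
  exact gI ▸ isPreconnected_image_Ioo gc

theorem cylInt_nonempty (hh : IsMarkovFamily f h) (hs : IsPathUpTo (Covers f h) s n) :
    (cylInt f h s n).Nonempty := by
  obtain ⟨g, -, -, -, gI⟩ := hh.exists_image_Ioo_eq_cylInt hs
  exact gI ▸ image_Ioo_nonempty g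

end Continuum

end IsMarkovFamily

end Cylinders

section Mixing

theorem IsTopMixing.iterate {X : Type*} [TopologicalSpace X] {f : X → X} (hf : IsTopMixing f)
    {k : ℕ} (hk : 0 < k) : IsTopMixing f^[k] := fun U V hU hV hUne hVne => by
  obtain ⟨N, hN⟩ := hf U V hU hV hUne hVne
  exact ⟨N, fun m hm => Function.iterate_mul f k m ▸ hN _ (hm.trans (Nat.le_mul_of_pos_left m hk))⟩

theorem IsTopMixing.of_semiconj {X Y : Type*} [TopologicalSpace X] [TopologicalSpace Y] {f : Y → Y}
    (hf : IsTopMixing f) {ψ : X → X} {g : X → Y} (hg : Function.Semiconj g ψ f)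
    (hopen : IsOpenMap g) (hinj : Function.Injective g) : IsTopMixing ψ :=
  fun U V hU hV hUne hVne => by
    obtain ⟨N, hN⟩ := hf _ _ (hopen U hU) (hopen V hV) (hUne.image g) (hVne.image g)
    refine ⟨N, fun m hm => ?_⟩
    obtain ⟨_, ⟨_, ⟨r, hr, rfl⟩, rfl⟩, r', hr', hrr'⟩ := hN m hm
    rw [← hg.iterate_right m r] at hrr'
    exact ⟨ψ^[m] r, mem_image_of_mem _ hr, hinj hrr' ▸ hr'⟩

theorem not_isTopMixing_of_invariant {X : Type*} [TopologicalSpace X] {ψ : X → X} {S U V : Set X}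
    (hS : MapsTo ψ S S) (hU : IsOpen U) (hUne : U.Nonempty) (hUS : U ⊆ S) (hV : IsOpen V)
    (hVne : V.Nonempty) (hSV : Disjoint S V) : ¬ IsTopMixing ψ := fun hmix => by
  obtain ⟨N, hN⟩ := hmix U V hU hV hUne hVne
  obtain ⟨_, ⟨r, hr, rfl⟩, hrV⟩ := hN N le_rfl
  exact disjoint_left.1 hSV (hS.iterate N (hUS hr)) hrV

theorem not_isTopMixing_of_monotone {X : Type*} [TopologicalSpace X] [LinearOrder X]
    [OrderClosedTopology X] [DenselyOrdered X] [Nontrivial X] {ψ : X → X} (hψ : Monotone ψ) :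
    ¬ IsTopMixing ψ := by
  obtain ⟨a, b, hab⟩ := exists_pair_lt X
  obtain ⟨c, hac, hcb⟩ := exists_between hab
  rcases le_total c (ψ c) with hc | hc
  · exact not_isTopMixing_of_invariant (S := Ici c) (fun r hr => hc.trans (hψ hr)) isOpen_Ioi
      ⟨b, hcb⟩ Ioi_subset_Ici_self isOpen_Iio ⟨a, hac⟩ (Ici_disjoint_Iio le_rfl)
  · exact not_isTopMixing_of_invariant (S := Iic c) (fun r hr => (hψ hr).trans hc) isOpen_Iio
      ⟨a, hac⟩ Iio_subset_Iic_self isOpen_Ioi ⟨b, hcb⟩ (Iic_disjoint_Ioi le_rfl)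

theorem not_isTopMixing_unitInterval {ψ : unitInterval → unitInterval} (hc : Continuous ψ)
    (hi : Function.Injective ψ) : ¬ IsTopMixing ψ := fun hmix => by
  refine not_isTopMixing_of_monotone ?_ (hmix.iterate two_pos)
  rcases hc.strictMono_of_inj_boundedOrder' hi with hm | hm
  · exact hm.monotone.iterate 2
  · exact (hm.comp hm).monotone

theorem not_isTopMixing_of_arc {G : Type*} [TopologicalSpace G] [T2Space G] {f : G → G}
    (hf : Continuous f) (fi : Function.Injective f) {g : unitInterval → G} (gc : Continuous g)
    (gi : Function.Injective g) (gs : Function.Surjective g) : ¬ IsTopMixing f := fun hmix => by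
  obtain ⟨ψ, ψc, hψ⟩ := exists_continuous_lift gc gi (hf.comp gc)
    (gs.range_eq ▸ subset_univ _)
  have ψi : Function.Injective ψ := fun a b hab =>
    gi (fi ((hψ a).symm.trans (hab ▸ hψ b)))
  exact not_isTopMixing_unitInterval ψc ψi
    (hmix.of_semiconj hψ (isHomeomorph_iff_continuous_bijective.2 ⟨gc, gi, gs⟩).isOpenMap gi)

end Mixing

section TransitionGraph

variable {G : Type*} {ι : Type*} {f : G → G} {h : ι → unitInterval → G}

theorem IsMarkovFamily.nontrivial_index [TopologicalSpace G] [T2Space G] [BaireSpace G]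
    [ConnectedSpace G] [Nonempty ι] (hh : IsMarkovFamily f h) : Nontrivial ι := by
  by_contra hn
  rw [not_nontrivial_iff_subsingleton] at hn
  obtain ⟨i⟩ := ‹Nonempty ι›
  have : Nontrivial G := (hh.injective i).nontrivial
  have hdense : Dense (range (h i)) := hh.dense_compl_exceptional.mono fun p hp => by
    obtain ⟨j, hj⟩ := notMem_exceptional.1 hp
    exact Subsingleton.elim j i ▸ image_subset_range _ _ hj
  have hrange : range (h i) = univ :=
    (isCompact_range (hh.continuous i)).isClosed.closure_eq ▸ hdense.closure_eq
  exact not_isTopMixing_of_arc hh.continuous_map (injOn_univ.1 (hrange ▸ hh.injOn i))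
    (hh.continuous i) (hh.injective i) (range_eq_univ.1 hrange) hh.mixing

variable [MetricSpace G] [CompactSpace G] [ConnectedSpace G]

theorem IsMarkovFamily.isMixingRel_covers (hh : IsMarkovFamily f h) :
    IsMixingRel (Covers f h) := fun i j => by
  obtain ⟨N, hN⟩ := hh.mixing _ _ (hh.isOpen i) (hh.isOpen j) (image_Ioo_nonempty _)
    (image_Ioo_nonempty _)
  filter_upwards [eventually_ge_atTop N] with n hn
  obtain ⟨_, ⟨p, hp, rfl⟩, hpj⟩ := hN n hn
  obtain ⟨s, hs⟩ := hh.exists_mem_cylInt (notMem_exceptional.2 ⟨j, hpj⟩)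
  exact ⟨s, hh.eq_of_mem (hs 0 n.zero_le) hp, hh.eq_of_mem (hs n le_rfl) hpj,
    hh.isPathUpTo_of_mem_cylInt hs⟩

end TransitionGraph

section SmallCylinders

variable {G : Type*} {ι : Type*} {f : G → G} {h : ι → unitInterval → G}

/-- The forward images of the subarc are connected and, by mixing, one of them meets the interiors
of two different partition arcs. -/
theorem IsMarkovFamily.exists_mem_Ioo_iterate_mem_exceptional [TopologicalSpace G] [T2Space G]
    [Nontrivial ι] (hh : IsMarkovFamily f h) (i : ι) {a b : unitInterval} (hab : a < b) :
    ∃ r ∈ Ioo a b, ∃ n, f^[n] (h i r) ∈ exceptional h := by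
  by_contra! hn
  obtain ⟨j, j', hjj'⟩ := exists_pair_ne ι
  have hopen : IsOpen (h i '' Ioo a b) := isOpen_image_of_subset_Ioo (hh.continuous i)
    (hh.injective i) (hh.isOpen i) isOpen_Ioo
    (Ioo_subset_Ioo unitInterval.nonneg' unitInterval.le_one')
  have hne : (h i '' Ioo a b).Nonempty := (nonempty_Ioo.2 hab).image _
  obtain ⟨N, hN⟩ := hh.mixing _ _ hopen (hh.isOpen j) hne (image_Ioo_nonempty _)
  obtain ⟨N', hN'⟩ := hh.mixing _ _ hopen (hh.isOpen j') hne (image_Ioo_nonempty _)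
  let n := max N N'
  have hpre : IsPreconnected (f^[n] '' (h i '' Ioo a b)) :=
    (isPreconnected_Ioo.image _ (hh.continuous i).continuousOn).image _
      (hh.continuous_map.iterate _).continuousOn
  have hcover : f^[n] '' (h i '' Ioo a b) ⊆
      h j '' Ioo 0 1 ∪ ⋃ k ∈ ({j}ᶜ : Set ι), h k '' Ioo 0 1 := by
    rintro _ ⟨_, ⟨r, hr, rfl⟩, rfl⟩
    obtain ⟨k, hk⟩ := notMem_exceptional.1 (hn r hr n)
    obtain rfl | hkj := eq_or_ne k j
    exacts [Or.inl hk, Or.inr (mem_biUnion hkj hk)]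
  have hdisj : Disjoint (h j '' Ioo 0 1) (⋃ k ∈ ({j}ᶜ : Set ι), h k '' Ioo 0 1) :=
    disjoint_iUnion₂_right.2 fun k hk => hh.disjoint j k (Ne.symm hk)
  have hsub := hpre.subset_left_of_subset_union (hh.isOpen j)
    (isOpen_biUnion fun k _ => hh.isOpen k) hdisj hcover (hN n (le_max_left _ _))
  obtain ⟨q, hq, hqj'⟩ := hN' n (le_max_right _ _)
  exact hjj' (hh.eq_of_mem (hsub hq) hqj')

theorem IsMarkovFamily.exists_mem_Ioo_iterate_notMem_exceptional [TopologicalSpace G] [Countable ι]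
    (hh : IsMarkovFamily f h) (i : ι) {a b : unitInterval} (hab : a < b) (n : ℕ) :
    ∃ r ∈ Ioo a b, f^[n] (h i r) ∉ exceptional h := by
  by_contra! hn
  exact not_countable_Ioo_unitInterval hab
    (((hh.countable_preimage_iterate hh.countable_exceptional n).preimage (hh.injective i)).mono hn)

namespace IsMarkovFamily

variable [MetricSpace G] [CompactSpace G] [ConnectedSpace G]

theorem cyl_subset_image_Icc (hh : IsMarkovFamily f h) {s : ℕ → ι} {n : ℕ}
    (hs : IsPathUpTo (Covers f h) s n) {i : ι} {a b : unitInterval}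
    (ha : f^[n] (h i a) ∈ exceptional h) (hb : f^[n] (h i b) ∈ exceptional h)
    (hne : (cylInt f h s n ∩ h i '' Ioo a b).Nonempty) : cyl f h s n ⊆ h i '' Icc a b := by
  have hopen : IsOpen (h i '' Ioo a b) := isOpen_image_of_subset_Ioo (hh.continuous i)
    (hh.injective i) (hh.isOpen i) isOpen_Ioo
    (Ioo_subset_Ioo unitInterval.nonneg' unitInterval.le_one')
  have hclosed : IsClosed (h i '' Icc a b) :=
    (isClosed_Icc.isCompact.image (hh.continuous i)).isClosed
  have hIoo : h i '' Ioo a b ⊆ h i '' Icc a b := image_mono Ioo_subset_Icc_self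
  have hcover : cylInt f h s n ⊆ h i '' Ioo a b ∪ (h i '' Icc a b)ᶜ := fun p hp => by
    by_contra hnot
    rw [mem_union, not_or, notMem_compl_iff] at hnot
    obtain ⟨hpIoo, r, hr, rfl⟩ := hnot
    have hrQ : f^[n] (h i r) ∉ exceptional h := (hh.mem_cylInt_iff.1 hp).2
    exact hpIoo ⟨r, ⟨hr.1.lt_of_ne (by rintro rfl; exact hrQ ha),
      hr.2.lt_of_ne (by rintro rfl; exact hrQ hb)⟩, rfl⟩
  rw [← hh.closure_cylInt hs]
  exact closure_minimal (((hh.isPreconnected_cylInt hs).subset_left_of_subset_union hopen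
    hclosed.isOpen_compl (disjoint_compl_right.mono_left hIoo) hcover hne).trans hIoo) hclosed

theorem exists_cyl_subset [Countable ι] [Nontrivial ι] (hh : IsMarkovFamily f h) {U : Set G}
    (hU : IsOpen U) (hne : U.Nonempty) :
    ∃ (s : ℕ → ι) (n : ℕ), IsPathUpTo (Covers f h) s n ∧ cyl f h s n ⊆ U := by
  have : Nontrivial G := (hh.injective (Classical.arbitrary ι)).nontrivial
  obtain ⟨p, hpU, hpQ⟩ := hh.dense_compl_exceptional.inter_open_nonempty U hU hne
  obtain ⟨i, τ, hτ, rfl⟩ := notMem_exceptional.1 hpQ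
  obtain ⟨a, b, ⟨haτ, hτb⟩, hab⟩ := (mem_nhds_iff_exists_Ioo_subset' ⟨0, hτ.1⟩ ⟨1, hτ.2⟩).1
    ((hU.preimage (hh.continuous i)).mem_nhds hpU)
  obtain ⟨r₁, hr₁, n₁, hn₁⟩ := hh.exists_mem_Ioo_iterate_mem_exceptional i haτ
  obtain ⟨r₂, hr₂, n₂, hn₂⟩ := hh.exists_mem_Ioo_iterate_mem_exceptional i hτb
  obtain ⟨r, hr, hrQ⟩ :=
    hh.exists_mem_Ioo_iterate_notMem_exceptional i (hr₁.2.trans hr₂.1) (max n₁ n₂)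
  obtain ⟨s, hs⟩ := hh.exists_mem_cylInt hrQ
  have hpath := hh.isPathUpTo_of_mem_cylInt hs
  refine ⟨s, max n₁ n₂, hpath, (hh.cyl_subset_image_Icc hpath
    (hh.iterate_mem_exceptional (le_max_left _ _) hn₁)
    (hh.iterate_mem_exceptional (le_max_right _ _) hn₂) ⟨_, hs, r, hr, rfl⟩).trans ?_⟩
  rintro _ ⟨σ, hσ, rfl⟩
  exact hab ⟨hr₁.1.trans_le hσ.1, hσ.2.trans_lt hr₂.2⟩

end IsMarkovFamily

end SmallCylinders

section Itineraries

variable {G : Type*} {ι : Type*} {f : G → G} {h : ι → unitInterval → G}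

namespace IsMarkovFamily

theorem exists_image_Ioo_subset_cyl [TopologicalSpace G] [T2Space G] (hh : IsMarkovFamily f h)
    {s : ℕ → ι} {n : ℕ} (hs : IsPathUpTo (Covers f h) s n) {τ : unitInterval}
    (hτ : h (s 0) τ ∈ cyl f h s n) :
    (∃ a < τ, h (s 0) '' Ioo a τ ⊆ cyl f h s n) ∨
      ∃ b > τ, h (s 0) '' Ioo τ b ⊆ cyl f h s n := by
  have hord : OrdConnected (h (s 0) ⁻¹' cyl f h s n) :=
    ((hh.isPreconnected_cyl hs).preimage_of_isClosedMap (hh.injective _)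
      (hh.continuous _).isClosedMap (cyl_subset_range f h s n)).ordConnected
  obtain ⟨p, hp, hpτ⟩ := (hh.nontrivial_cyl hs).exists_ne (h (s 0) τ)
  obtain ⟨σ, rfl⟩ := cyl_subset_range f h s n hp
  obtain hσ | hσ := lt_or_gt_of_ne (ne_of_apply_ne _ hpτ)
  · exact Or.inl ⟨σ, hσ, image_subset_iff.2 (Ioo_subset_Icc_self.trans (hord.out hp hτ))⟩
  · exact Or.inr ⟨σ, hσ, image_subset_iff.2 (Ioo_subset_Icc_self.trans (hord.out hτ hp))⟩

variable [MetricSpace G] [CompactSpace G] [ConnectedSpace G] [Countable ι]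

theorem eq_of_forall_image_Ioo_subset_cyl (hh : IsMarkovFamily f h) {i : ι} {s t : ℕ → ι}
    (hst : ∀ n, ∃ a b, a < b ∧ h i '' Ioo a b ⊆ cyl f h s n ∩ cyl f h t n) : s = t := by
  funext n
  obtain ⟨a, b, hab, hsub⟩ := hst n
  obtain ⟨r, hr, hrn⟩ := hh.exists_mem_Ioo_iterate_notMem_exceptional i hab n
  obtain ⟨hrs, hrt⟩ := hsub (mem_image_of_mem _ hr)
  exact hh.apply_eq_of_mem_cyl hrs hrt hrn le_rfl

/-- An itinerary of `x` is determined by the arc containing `x` and the side of `x` on which its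
cylinders accumulate. -/
theorem countable_itineraries (hh : IsMarkovFamily f h) (x : G) :
    {s ∈ paths (Covers f h) | ∀ n, x ∈ cyl f h s n}.Countable := by
  let left (i : ι) (τ : unitInterval) : Set (ℕ → ι) :=
    {s | ∀ n, ∃ a < τ, h i '' Ioo a τ ⊆ cyl f h s n}
  let right (i : ι) (τ : unitInterval) : Set (ℕ → ι) :=
    {s | ∀ n, ∃ b > τ, h i '' Ioo τ b ⊆ cyl f h s n}
  have hleft (i τ) : (left i τ).Subsingleton := fun s hs t ht =>
    hh.eq_of_forall_image_Ioo_subset_cyl fun n => by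
      obtain ⟨a, ha, hsa⟩ := hs n
      obtain ⟨b, hb, htb⟩ := ht n
      exact ⟨max a b, τ, max_lt ha hb, subset_inter
        ((image_mono (Ioo_subset_Ioo_left (le_max_left _ _))).trans hsa)
        ((image_mono (Ioo_subset_Ioo_left (le_max_right _ _))).trans htb)⟩
  have hright (i τ) : (right i τ).Subsingleton := fun s hs t ht =>
    hh.eq_of_forall_image_Ioo_subset_cyl fun n => by
      obtain ⟨a, ha, hsa⟩ := hs n
      obtain ⟨b, hb, htb⟩ := ht n
      exact ⟨τ, min a b, lt_min ha hb, subset_inter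
        ((image_mono (Ioo_subset_Ioo_right (min_le_left _ _))).trans hsa)
        ((image_mono (Ioo_subset_Ioo_right (min_le_right _ _))).trans htb)⟩
  refine (countable_iUnion fun i => ((countable_singleton x).preimage (hh.injective i)).biUnion
    fun τ _ => (hleft i τ).countable.union (hright i τ).countable).mono ?_
  rintro s ⟨hs, hxs⟩
  obtain ⟨τ, rfl⟩ := cyl_subset_range f h s 0 (hxs 0)
  refine mem_iUnion.2 ⟨s 0, mem_biUnion (x := τ) rfl ?_⟩
  by_contra! hnot
  simp only [left, right, mem_union, mem_ofPred_eq, not_or, not_forall] at hnot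
  obtain ⟨⟨m, hm⟩, n, hn⟩ := hnot
  obtain ⟨a, ha, hsa⟩ | ⟨b, hb, hsb⟩ := hh.exists_image_Ioo_subset_cyl
    (isPathUpTo_of_mem_paths hs (max m n)) (hxs _)
  · exact hm ⟨a, ha, hsa.trans (cyl_antitone f h s (le_max_left _ _))⟩
  · exact hn ⟨b, hb, hsb.trans (cyl_antitone f h s (le_max_right _ _))⟩

end IsMarkovFamily

end Itineraries

section PathsWithin

open MeasureTheory

variable {G : Type*} {ι : Type*}

/-- The itineraries whose first `n + 1` symbols determine a cylinder contained in `γ`; their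
measure is the number `A_n(γ)` of the paper. -/
def pathsWithin (f : G → G) (h : ι → unitInterval → G) (γ : Set G) (n : ℕ) : Set (ℕ → ι) :=
  {s ∈ paths (Covers f h) | cyl f h s n ⊆ γ}

/-- The itineraries that have a cylinder contained in `γ`; their measure is the number `A(γ)` of
the paper. -/
def pathsEventuallyWithin (f : G → G) (h : ι → unitInterval → G) (γ : Set G) : Set (ℕ → ι) :=
  ⋃ n, pathsWithin f h γ n

theorem monotone_pathsWithin (f : G → G) (h : ι → unitInterval → G) (γ : Set G) :
    Monotone (pathsWithin f h γ) :=
  fun _ _ hmn s hs => ⟨hs.1, (cyl_antitone f h s hmn).trans hs.2⟩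

variable {f : G → G} {h : ι → unitInterval → G} {γ γ₁ γ₂ : Set G} {s : ℕ → ι}

theorem mem_pathsEventuallyWithin :
    s ∈ pathsEventuallyWithin f h γ ↔ s ∈ paths (Covers f h) ∧ ∃ n, cyl f h s n ⊆ γ := by
  simp only [pathsEventuallyWithin, pathsWithin, mem_iUnion, mem_ofPred_eq, exists_and_left]

theorem pathsEventuallyWithin_mono (hγ : γ₁ ⊆ γ₂) :
    pathsEventuallyWithin f h γ₁ ⊆ pathsEventuallyWithin f h γ₂ :=
  iUnion_mono fun _ _ hs => ⟨hs.1, hs.2.trans hγ⟩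

theorem measurableSet_pathsWithin [Countable ι] [MeasurableSpace ι] [MeasurableSingletonClass ι]
    (f : G → G) (h : ι → unitInterval → G) (γ : Set G) (n : ℕ) :
    MeasurableSet (pathsWithin f h γ n) :=
  (measurableSet_paths _).inter <| measurableSet_of_forall_initialWord_eq (n := n)
    fun _ _ hst => (cyl_congr f h (initialWord_eq_iff.1 hst)).symm.subset.trans

theorem measurableSet_pathsEventuallyWithin [Countable ι] [MeasurableSpace ι]
    [MeasurableSingletonClass ι] (f : G → G) (h : ι → unitInterval → G) (γ : Set G) :
    MeasurableSet (pathsEventuallyWithin f h γ) :=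
  MeasurableSet.iUnion (measurableSet_pathsWithin f h γ)

theorem measure_pathsEventuallyWithin_eq_iSup [MeasurableSpace ι] (f : G → G)
    (h : ι → unitInterval → G) (γ : Set G) (μ : Measure (ℕ → ι)) :
    μ (pathsEventuallyWithin f h γ) = ⨆ n, μ (pathsWithin f h γ n) :=
  (monotone_pathsWithin f h γ).measure_iUnion

namespace IsMarkovFamily

section Topological

variable [TopologicalSpace G] [T2Space G]

theorem disjoint_pathsEventuallyWithin (hh : IsMarkovFamily f h)
    (hγ : (γ₁ ∩ γ₂).Subsingleton) :
    Disjoint (pathsEventuallyWithin f h γ₁) (pathsEventuallyWithin f h γ₂) := by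
  refine disjoint_left.2 fun s hs₁ hs₂ => ?_
  obtain ⟨hs, m, hm⟩ := mem_pathsEventuallyWithin.1 hs₁
  obtain ⟨-, n, hn⟩ := mem_pathsEventuallyWithin.1 hs₂
  exact (hh.nontrivial_cyl (isPathUpTo_of_mem_paths hs (max m n))).not_subsingleton <|
    hγ.anti <| subset_inter ((cyl_antitone f h s (le_max_left m n)).trans hm)
      ((cyl_antitone f h s (le_max_right m n)).trans hn)

theorem mem_pathsEventuallyWithin_of_union (hh : IsMarkovFamily f h) (h₁ : IsClosed γ₁)
    (h₂ : IsClosed γ₂) {t : G} (ht : γ₁ ∩ γ₂ ⊆ {t}) {n : ℕ} (htn : t ∉ cyl f h s n)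
    (hs : s ∈ pathsEventuallyWithin f h (γ₁ ∪ γ₂)) :
    s ∈ pathsEventuallyWithin f h γ₁ ∪ pathsEventuallyWithin f h γ₂ := by
  obtain ⟨hs, m, hm⟩ := mem_pathsEventuallyWithin.1 hs
  have hsub : cyl f h s (max m n) ⊆ γ₁ ∪ γ₂ := (cyl_antitone f h s (le_max_left m n)).trans hm
  have hempty : cyl f h s (max m n) ∩ (γ₁ ∩ γ₂) = ∅ :=
    eq_empty_of_forall_notMem fun z hz =>
      htn (ht hz.2 ▸ cyl_antitone f h s (le_max_right m n) hz.1)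
  have hpath := isPathUpTo_of_mem_paths hs (max m n)
  refine (((isPreconnected_iff_subset_of_disjoint_closed.1 (hh.isPreconnected_cyl hpath))
    γ₁ γ₂ h₁ h₂ hsub hempty).imp ?_ ?_) <;>
  exact fun hcyl => mem_pathsEventuallyWithin.2 ⟨hs, _, hcyl⟩

theorem mem_of_mem_iInter_pathsEventuallyWithin (hh : IsMarkovFamily f h) {κ : Type*}
    [Nonempty κ] {γ : κ → Set G} {x : G} (hx : ⋂ m, γ m ⊆ {x})
    (hs : s ∈ ⋂ m, pathsEventuallyWithin f h (γ m)) (n : ℕ) : x ∈ cyl f h s n := by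
  have hmem (m) := mem_pathsEventuallyWithin.1 (mem_iInter.1 hs m)
  have hpath (k) := isPathUpTo_of_mem_paths (hmem (Classical.arbitrary κ)).1 k
  obtain ⟨z, hz⟩ := IsCompact.nonempty_iInter_of_directed_nonempty_isCompact_isClosed
    (cyl f h s) (cyl_antitone f h s).directed_ge
    (fun k => (hh.nontrivial_cyl (hpath k)).nonempty) (fun k => hh.isCompact_cyl (hpath k))
    fun k => (hh.isCompact_cyl (hpath k)).isClosed
  rw [mem_iInter] at hz
  have hzx : z = x := hx <| mem_iInter.2 fun m => (hmem m).2.elim fun k hk => hk (hz k)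
  exact hzx ▸ hz n

end Topological

variable [MetricSpace G] [CompactSpace G] [ConnectedSpace G] [Countable ι] [MeasurableSpace ι]
  {μ : Measure (ℕ → ι)} [NullSingletonClass μ]

theorem measure_itineraries_eq_zero (hh : IsMarkovFamily f h) (x : G) :
    μ {s ∈ paths (Covers f h) | ∀ n, x ∈ cyl f h s n} = 0 :=
  (hh.countable_itineraries x).measure_zero μ

theorem ae_exists_notMem_cyl (hh : IsMarkovFamily f h) (hμ : ∀ᵐ s ∂μ, s ∈ paths (Covers f h))
    (x : G) : ∀ᵐ s ∂μ, ∃ n, x ∉ cyl f h s n := by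
  filter_upwards [hμ, measure_eq_zero_iff_ae_notMem.1 (hh.measure_itineraries_eq_zero x)]
    with s hs hx
  by_contra! hn
  exact hx ⟨hs, hn⟩

variable [MeasurableSingletonClass ι]

theorem measure_pathsEventuallyWithin_union (hh : IsMarkovFamily f h)
    (hμ : ∀ᵐ s ∂μ, s ∈ paths (Covers f h)) (h₁ : IsClosed γ₁) (h₂ : IsClosed γ₂) {t : G}
    (ht : γ₁ ∩ γ₂ = {t}) :
    μ (pathsEventuallyWithin f h (γ₁ ∪ γ₂)) =
      μ (pathsEventuallyWithin f h γ₁) + μ (pathsEventuallyWithin f h γ₂) := by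
  rw [← measure_union (hh.disjoint_pathsEventuallyWithin (ht ▸ subsingleton_singleton))
    (measurableSet_pathsEventuallyWithin f h γ₂)]
  refine measure_congr (eventuallyEq_set.2 ?_)
  filter_upwards [hh.ae_exists_notMem_cyl hμ t] with s ⟨n, hn⟩
  exact ⟨hh.mem_pathsEventuallyWithin_of_union h₁ h₂ ht.subset hn,
    fun hs => union_subset (pathsEventuallyWithin_mono subset_union_left)
      (pathsEventuallyWithin_mono subset_union_right) hs⟩

theorem tendsto_measure_pathsEventuallyWithin [IsFiniteMeasure μ] (hh : IsMarkovFamily f h)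
    {γ : ℕ → Set G} {x : G} (hγ : Antitone γ) (hx : ⋂ m, γ m ⊆ {x}) :
    Tendsto (fun m => μ (pathsEventuallyWithin f h (γ m))) atTop (𝓝 0) := by
  have hzero : μ (⋂ m, pathsEventuallyWithin f h (γ m)) = 0 :=
    measure_mono_null (fun s hs => mem_sep (mem_pathsEventuallyWithin.1 (mem_iInter.1 hs 0)).1
      (hh.mem_of_mem_iInter_pathsEventuallyWithin hx hs)) (hh.measure_itineraries_eq_zero x)
  exact hzero ▸ tendsto_measure_iInter_atTop
    (fun m => (measurableSet_pathsEventuallyWithin f h (γ m)).nullMeasurableSet)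
    (fun _ _ hmn => pathsEventuallyWithin_mono (hγ hmn)) ⟨0, measure_ne_top μ _⟩

end IsMarkovFamily

section Positivity

theorem IsArcFamily.interior_nonempty_of_isArc [TopologicalSpace G] [T2Space G]
    (hh : IsArcFamily h) {γ : Set G} (hγ : IsArc γ) : (interior γ).Nonempty := by
  obtain ⟨_, _, g, gc, gi, rfl, -, -⟩ := hγ
  obtain ⟨t, ht, hgt⟩ : ∃ t ∈ Ioo (0 : unitInterval) 1, g t ∉ exceptional h := by
    by_contra! hn
    exact not_countable_Ioo_unitInterval zero_lt_one
      ((hh.countable_exceptional.preimage gi).mono hn)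
  obtain ⟨i, hi⟩ := notMem_exceptional.1 hgt
  exact ⟨g t, mem_interior_range (hh.continuous i) (hh.injective i) (hh.isOpen i) gc gi ht hi⟩

theorem IsMarkovFamily.measure_pathsEventuallyWithin_pos [MetricSpace G] [CompactSpace G]
    [ConnectedSpace G] [Countable ι] [Nontrivial ι] [MeasurableSpace ι] {v : ι → ℝ} {lam : ℝ}
    {μ : Measure (ℕ → ι)} (hh : IsMarkovFamily f h)
    (hv : IsNormalizedSubeigenvector (Covers f h) lam v) (hμ : IsPathMeasure (Covers f h) v μ)
    {γ : Set G} (hγ : (interior γ).Nonempty) : 0 < μ (pathsEventuallyWithin f h γ) := by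
  obtain ⟨s, n, hs, hsub⟩ := hh.exists_cyl_subset isOpen_interior hγ
  have hword : μ (initialWord n ⁻¹' {initialWord n s}) ≤ μ (pathsEventuallyWithin f h γ) := by
    refine measure_mono_ae ?_
    filter_upwards [hμ.ae_mem_paths] with t ht hst
    have hcyl : cyl f h t n = cyl f h s n := cyl_congr f h (initialWord_eq_iff.1 hst)
    exact mem_pathsEventuallyWithin.2 ⟨ht, n, hcyl.trans_subset (hsub.trans interior_subset)⟩
  refine lt_of_lt_of_le ?_ hword
  rw [hμ.measure_word n s hs, ENNReal.ofReal_pos]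
  exact hv.pathWeight_pos hh.isMixingRel_covers s n

end Positivity

end PathsWithin

section UpperLimit

variable {X : Type*} [TopologicalSpace X] {β : ℕ → Set X}

/-- The Kuratowski upper limit of a sequence of sets: the points all of whose neighbourhoods meet
infinitely many of the sets. -/
def upperLimit (β : ℕ → Set X) : Set X :=
  ⋂ N, closure (⋃ k ≥ N, β k)

theorem isClosed_upperLimit (β : ℕ → Set X) : IsClosed (upperLimit β) :=
  isClosed_iInter fun _ => isClosed_closure

theorem mem_upperLimit_of_forall_mem {x : X} (hx : ∀ k, x ∈ β k) : x ∈ upperLimit β :=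
  mem_iInter.2 fun N => subset_closure (mem_biUnion (le_refl N) (hx N))

theorem frequently_inter_nonempty_of_mem_upperLimit {z : X} (hz : z ∈ upperLimit β) {U : Set X}
    (hU : IsOpen U) (hzU : z ∈ U) : ∃ᶠ k in atTop, (β k ∩ U).Nonempty := by
  refine frequently_atTop.2 fun N => ?_
  obtain ⟨w, hwU, hw⟩ := mem_closure_iff.1 (mem_iInter.1 hz N) U hU hzU
  obtain ⟨k, hk, hwk⟩ := mem_iUnion₂.1 hw
  exact ⟨k, hk, w, hwk, hwU⟩

theorem isPreconnected_upperLimit [T2Space X] [CompactSpace X] (hβ : ∀ k, IsPreconnected (β k))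
    {x : X} (hx : ∀ k, x ∈ β k) : IsPreconnected (upperLimit β) := by
  have hanti : Antitone fun N => closure (⋃ k ≥ N, β k) := fun N M hNM =>
    closure_mono (biUnion_subset_biUnion_left fun k hk => le_trans hNM hk)
  refine isPreconnected_iInter_of_directed hanti.directed_ge (fun N => isClosed_closure.isCompact)
    fun N => (isPreconnected_of_forall x fun z hz => ?_).closure
  obtain ⟨k, hk, hzk⟩ := mem_iUnion₂.1 hz
  exact ⟨β k, subset_biUnion_of_mem hk, hx k, hzk, hβ k⟩

end UpperLimit

section MinimalArc

open MeasureTheory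

theorem exists_strictMono_eventually_of_frequently {κ : Type*} [Countable κ]
    (p : κ → ℕ → Prop) : ∃ θ : ℕ → ℕ, StrictMono θ ∧
      ∀ w, (∃ᶠ k in atTop, p w (θ k)) → ∀ᶠ k in atTop, p w (θ k) := by
  classical
  obtain ⟨b, -, θ, hθ, hlim⟩ := isCompact_univ.tendsto_subseq
    (x := fun k (w : κ) => decide (p w k)) fun _ => mem_univ _
  refine ⟨θ, hθ, fun w hfreq => ?_⟩
  have hconst : ∀ᶠ k in atTop, decide (p w (θ k)) = b w := by
    simpa only [nhds_discrete, tendsto_pure, Function.comp_apply] using tendsto_pi_nhds.1 hlim w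
  obtain ⟨m, hm, hbm⟩ := (hfreq.and_eventually hconst).exists
  filter_upwards [hconst] with k hk
  exact of_decide_eq_true (hk.trans (hbm.symm.trans (decide_eq_true hm)))

theorem measure_le_of_ae_eventually_mem {α : Type*} [MeasurableSpace α] {μ : Measure α}
    {E : Set α} {F : ℕ → Set α} {c : ℝ≥0∞} (hE : ∀ᵐ s ∂μ, s ∈ E → ∀ᶠ k in atTop, s ∈ F k)
    (hF : Tendsto (fun k => μ (F k)) atTop (𝓝 c)) : μ E ≤ c := by
  have hmono : Monotone fun N => ⋂ k ≥ N, F k := fun _ _ hNM =>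
    biInter_subset_biInter_left fun _ hk => le_trans hNM hk
  calc μ E ≤ μ (⋃ N, ⋂ k ≥ N, F k) := by
        refine measure_mono_ae ?_
        filter_upwards [hE] with s hs hsE
        obtain ⟨N, hN⟩ := eventually_atTop.1 (hs hsE)
        exact mem_iUnion.2 ⟨N, mem_iInter₂.2 hN⟩
    _ = ⨆ N, μ (⋂ k ≥ N, F k) := hmono.measure_iUnion
    _ ≤ c := iSup_le fun N => ge_of_tendsto hF <| by
        filter_upwards [eventually_ge_atTop N] with k hk
        exact measure_mono (biInter_subset_of_mem hk)

section ArcBetween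

variable {X : Type*} [TopologicalSpace X] {x y : X} {γ : Set X}

theorem IsArcBetween.left_mem (hγ : IsArcBetween x y γ) : x ∈ γ := by
  obtain ⟨g, -, -, rfl, rfl, -⟩ := hγ
  exact mem_range_self 0

theorem IsArcBetween.isPreconnected (hγ : IsArcBetween x y γ) : IsPreconnected γ := by
  obtain ⟨g, gc, -, rfl, -⟩ := hγ
  exact isPreconnected_range gc

end ArcBetween

variable {G : Type*} {ι : Type*} {f : G → G} {h : ι → unitInterval → G}

theorem exists_strictMono_eventually_cyl_subset [Countable ι] (f : G → G)
    (h : ι → unitInterval → G) (β : ℕ → Set G) : ∃ θ : ℕ → ℕ, StrictMono θ ∧ ∀ s n,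
      (∃ᶠ k in atTop, cyl f h s n ⊆ β (θ k)) → ∀ᶠ k in atTop, cyl f h s n ⊆ β (θ k) := by
  obtain ⟨θ, hθ, hstable⟩ := exists_strictMono_eventually_of_frequently
    fun (w : Σ n, (Fin (n + 1) → ι)) k => ∀ s, initialWord w.1 s = w.2 → cyl f h s w.1 ⊆ β k
  refine ⟨θ, hθ, fun s n hfreq => ?_⟩
  filter_upwards [hstable ⟨n, initialWord n s⟩ (hfreq.mono fun k hk t ht =>
    (cyl_congr f h (initialWord_eq_iff.1 ht)).trans_subset hk)] with k hk
  exact hk s rfl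

namespace IsMarkovFamily

variable [MetricSpace G] [CompactSpace G] [ConnectedSpace G]

theorem cyl_subset_of_isArcBetween (hh : IsMarkovFamily f h) {s : ℕ → ι} {n : ℕ}
    (hs : IsPathUpTo (Covers f h) s n) {x y : G} {γ : Set G} (hγ : IsArcBetween x y γ)
    (hx : x ∉ cyl f h s n) (hy : y ∉ cyl f h s n) (hne : (γ ∩ cylInt f h s n).Nonempty) :
    cyl f h s n ⊆ γ := by
  obtain ⟨k, kc, ki, rfl, rfl, rfl⟩ := hγ
  obtain ⟨g, gc, gi, -, hg⟩ := hh.exists_image_Ioo_eq_cylInt hs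
  have hsub := image_Ioo_subset_range_of_inter_nonempty gc gi (hg ▸ hh.isOpen_cylInt s n) kc ki
    (fun h0 => hx (cylInt_subset_cyl (hg ▸ h0))) (fun h1 => hy (cylInt_subset_cyl (hg ▸ h1)))
    (hg ▸ hne)
  rw [← hh.closure_cylInt hs, ← hg]
  exact closure_minimal hsub (isCompact_range kc).isClosed

theorem frequently_cyl_subset (hh : IsMarkovFamily f h) {β : ℕ → Set G} {x y : G}
    (hβ : ∀ k, IsArcBetween x y (β k)) {s : ℕ → ι} {n : ℕ} (hs : IsPathUpTo (Covers f h) s n)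
    (hx : x ∉ cyl f h s n) (hy : y ∉ cyl f h s n) (hsub : cyl f h s n ⊆ upperLimit β) :
    ∃ᶠ k in atTop, cyl f h s n ⊆ β k := by
  obtain ⟨z, hz⟩ := hh.cylInt_nonempty hs
  exact (frequently_inter_nonempty_of_mem_upperLimit (hsub (cylInt_subset_cyl hz))
    (hh.isOpen_cylInt s n) hz).mono fun k => hh.cyl_subset_of_isArcBetween hs (hβ k) hx hy

variable [Countable ι] [MeasurableSpace ι] {μ : Measure (ℕ → ι)} [NullSingletonClass μ]

/-- Lower semicontinuity of `A` along a sequence of arcs: almost every itinerary that has a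
cylinder in `α` has one that avoids `x` and `y`, hence lies in almost all arcs of the sequence. -/
theorem measure_le_of_subset_upperLimit (hh : IsMarkovFamily f h)
    (hμ : ∀ᵐ s ∂μ, s ∈ paths (Covers f h)) {β : ℕ → Set G} {x y : G}
    (hβ : ∀ k, IsArcBetween x y (β k))
    (hstable : ∀ s n, (∃ᶠ k in atTop, cyl f h s n ⊆ β k) → ∀ᶠ k in atTop, cyl f h s n ⊆ β k)
    {c : ℝ≥0∞} (hc : Tendsto (fun k => μ (pathsEventuallyWithin f h (β k))) atTop (𝓝 c))
    {α : Set G} (hα : α ⊆ upperLimit β) : μ (pathsEventuallyWithin f h α) ≤ c := by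
  refine measure_le_of_ae_eventually_mem ?_ hc
  filter_upwards [hh.ae_exists_notMem_cyl hμ x, hh.ae_exists_notMem_cyl hμ y]
    with s ⟨m, hxm⟩ ⟨m', hym'⟩ hs
  obtain ⟨hs, n, hn⟩ := mem_pathsEventuallyWithin.1 hs
  have hanti := cyl_antitone f h s
  let N := max n (max m m')
  have hfreq : ∃ᶠ k in atTop, cyl f h s N ⊆ β k :=
    hh.frequently_cyl_subset hβ (isPathUpTo_of_mem_paths hs N)
      (fun hx => hxm (hanti ((le_max_left _ _).trans (le_max_right _ _)) hx))
      (fun hy => hym' (hanti ((le_max_right _ _).trans (le_max_right _ _)) hy))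
      ((hanti (le_max_left _ _)).trans (hn.trans hα))
  filter_upwards [hstable s N hfreq] with k hk
  exact mem_pathsEventuallyWithin.2 ⟨hs, N, hk⟩

theorem exists_isArcBetween_measure_le (hh : IsMarkovFamily f h)
    (hμ : ∀ᵐ s ∂μ, s ∈ paths (Covers f h)) {x y : G} (hxy : x ≠ y) :
    ∃ α, IsArcBetween x y α ∧ ∀ β, IsArcBetween x y β →
      μ (pathsEventuallyWithin f h α) ≤ μ (pathsEventuallyWithin f h β) := by
  let A (γ : Set G) : ℝ≥0∞ := μ (pathsEventuallyWithin f h γ)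
  obtain ⟨γ, -, hγ⟩ := hh.exists_isArcBetween isCompact_univ isPreconnected_univ (mem_univ x)
    (mem_univ y) hxy
  obtain ⟨u, -, hu, huA⟩ := exists_seq_tendsto_sInf
    (S := A '' {γ | IsArcBetween x y γ}) ⟨_, γ, hγ, rfl⟩ (OrderBot.bddBelow _)
  choose β hβ hβu using huA
  obtain rfl : (fun k => A (β k)) = u := funext hβu
  obtain ⟨θ, hθ, hstable⟩ := exists_strictMono_eventually_cyl_subset f h β
  have hβθ (k) : IsArcBetween x y (β (θ k)) := hβ (θ k)
  obtain ⟨α, hα, hαxy⟩ := hh.exists_isArcBetween (isClosed_upperLimit _).isCompact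
    (isPreconnected_upperLimit (fun k => (hβθ k).isPreconnected) fun k => (hβθ k).left_mem)
    (mem_upperLimit_of_forall_mem fun k => (hβθ k).left_mem)
    (mem_upperLimit_of_forall_mem fun k => (hβθ k).symm.left_mem) hxy
  exact ⟨α, hαxy, fun β' hβ' => (hh.measure_le_of_subset_upperLimit hμ hβθ hstable
    (hu.comp hθ.tendsto_atTop) hα).trans (sInf_le ⟨β', hβ', rfl⟩)⟩

end IsMarkovFamily

end MinimalArc

section Partitions

open MeasureTheory

variable {G : Type*} {f : G → G} {P : Set (Set G)} {h : P → unitInterval → G}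

theorem isCompact_of_mem_pointsAndArcs {X : Type*} [TopologicalSpace X] {γ : Set X}
    (hγ : γ ∈ pointsAndArcs X) : IsCompact γ := by
  rcases hγ with ⟨x, rfl⟩ | ⟨x, y, g, gc, -, rfl, -⟩
  · exact isCompact_singleton
  · exact isCompact_range gc

theorem IsMarkovPartition.exists_isMarkovFamily [TopologicalSpace G] [T2Space G]
    (hP : IsMarkovPartition f P) (hf : Continuous f) (hmix : IsTopMixing f) :
    ∃ h : P → unitInterval → G, IsMarkovFamily f h ∧ ∀ i, range (h i) = i := by
  choose h hc hi hr hint ho using fun i : P => (hP.tame.freeArc i i.2).exists_param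
  have := hP.tame.countable.to_subtype
  refine ⟨h, ⟨⟨hc, hi, ho, fun i j hij => ?_, ?_⟩, hf, fun i => ?_, fun i j hij => ?_, hmix⟩, hr⟩
  · rw [← hint, ← hint]
    exact hP.tame.disjoint i i.2 j j.2 (Subtype.coe_ne_coe.2 hij)
  · have hends : (⋃ i, {h i 0, h i 1}).Countable :=
      countable_iUnion fun i => (toFinite {h i 0, h i 1}).countable
    refine (hP.tame.cover.union hends).mono fun z hz => or_iff_not_imp_left.2 fun hzP => ?_
    obtain ⟨i, hiP, hzi⟩ := not_not.1 hzP
    by_contra hzends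
    refine hz (mem_iUnion.2 ⟨⟨i, hiP⟩, ?_⟩)
    rw [image_Ioo_eq_range_diff (hi _), hr]
    exact ⟨hzi, fun hzh => hzends (mem_iUnion.2 ⟨_, hzh⟩)⟩
  · rw [hr]
    exact injOn_iff_injective.2 (hP.monotone i i.2).injective
  · rw [hr, hr]
    rw [hr, ← hint] at hij
    exact hP.markov i i.2 j j.2 hij

theorem transition_eq_adjacency (hr : ∀ i, range (h i) = i) :
    transition f P = adjacency (Covers f h) := by
  ext i j
  have hcovers : (j : Set G) ⊆ f '' i ↔ Covers f h i j := by rw [Covers, hr, hr]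
  rw [transition, adjacency]
  congr 1
  exact propext hcovers

theorem rate_eq_expansionRate (hr : ∀ i, range (h i) = i) (v : P → ℝ) :
    rate f P v = expansionRate (Covers f h) v := by
  ext i
  rw [rate, expansionRate, transition_eq_adjacency hr]

theorem IsSubeigenvector.isNormalizedSubeigenvector {v : P → ℝ} {lam : ℝ}
    (hv : IsSubeigenvector f P lam v) (hr : ∀ i, range (h i) = i) (hlam : 1 < lam)
    (hsum : HasSum v 1) (hfin : {i | rate f P v i < lam}.Finite) :
    IsNormalizedSubeigenvector (Covers f h) lam v where
  one_lt := hlam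
  nonneg := hv.nonneg
  hasSum := hsum
  summable := transition_eq_adjacency hr ▸ hv.summable
  le := transition_eq_adjacency hr ▸ hv.le
  finite := rate_eq_expansionRate hr v ▸ hfin

theorem weight_initialWord (hr : ∀ i, range (h i) = i) (v : P → ℝ) (s : ℕ → P) (n : ℕ) :
    weight f P v (initialWord n s) = pathWeight (Covers f h) v s n := by
  rw [weight, pathWeight, Finset.prod_range, rate_eq_expansionRate hr]
  rfl

theorem cylinder_initialWord (hr : ∀ i, range (h i) = i) (s : ℕ → P) (n : ℕ) :
    cylinder f (initialWord n s) = cyl f h s n := by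
  ext p
  simp only [cylinder, cyl, initialWord, hr, mem_iInter, mem_preimage, mem_ofPred_eq,
    Fin.forall_iff, Nat.lt_succ_iff]

theorem partitionPoints_eq_exceptional [TopologicalSpace G] [T2Space G]
    (hc : ∀ i, Continuous (h i)) (hi : ∀ i, Function.Injective (h i))
    (hr : ∀ i, range (h i) = i) : partitionPoints P = exceptional h := by
  simp only [partitionPoints, exceptional, biUnion_eq_iUnion, ← hr, arcInterior_range (hc _) (hi _)]

namespace IsMarkovFamily

variable [MetricSpace G] [CompactSpace G] [ConnectedSpace G]

theorem connectedComponentIn_eq_cylInt {ι : Type*} {h : ι → unitInterval → G}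
    (hh : IsMarkovFamily f h) {s : ℕ → ι} {n : ℕ} (hs : IsPathUpTo (Covers f h) s n) {x : G}
    (hx : x ∈ cylInt f h s n) :
    connectedComponentIn (f^[n] ⁻¹' exceptional h)ᶜ x = cylInt f h s n := by
  have hsub : cylInt f h s n ⊆ (f^[n] ⁻¹' exceptional h)ᶜ := fun z hz => (hh.mem_cylInt_iff.1 hz).2
  refine Subset.antisymm ?_ ((hh.isPreconnected_cylInt hs).subset_connectedComponentIn hx hsub)
  refine isPreconnected_connectedComponentIn.subset_left_of_subset_union (hh.isOpen_cylInt s n)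
    (hh.isCompact_cyl hs).isClosed.isOpen_compl
    (disjoint_compl_right.mono_left cylInt_subset_cyl) (fun z hz => ?_)
    ⟨x, mem_connectedComponentIn (hsub hx), hx⟩
  exact (em (z ∈ cyl f h s n)).imp_left fun hzs =>
    hh.mem_cylInt_iff.2 ⟨hzs, connectedComponentIn_subset _ _ hz⟩

variable {s : ℕ → P} {n : ℕ}

theorem cyl_mem_refinement_iff (hh : IsMarkovFamily f h) (hr : ∀ i, range (h i) = i) :
    cyl f h s n ∈ refinement f P n ↔ IsPathUpTo (Covers f h) s n := by
  simp only [refinement, partitionPoints_eq_exceptional hh.continuous hh.injective hr,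
    mem_ofPred_eq]
  constructor
  · rintro ⟨x, hx, hcyl⟩
    have hxs : x ∈ cyl f h s n := hcyl ▸ subset_closure (mem_connectedComponentIn hx)
    exact hh.isPathUpTo_of_mem_cylInt (hh.mem_cylInt_iff.2 ⟨hxs, hx⟩)
  · intro hs
    obtain ⟨x, hx⟩ := hh.cylInt_nonempty hs
    refine ⟨x, (hh.mem_cylInt_iff.1 hx).2, ?_⟩
    rw [hh.connectedComponentIn_eq_cylInt hs hx, hh.closure_cylInt hs]

variable [Countable P] [Nonempty P] [MeasurableSpace P] [MeasurableSingletonClass P]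
  {v : P → ℝ} {μ : Measure (ℕ → P)}

theorem arcMapN_eq_measure (hh : IsMarkovFamily f h) (hr : ∀ i, range (h i) = i)
    (hμ : IsPathMeasure (Covers f h) v μ) (n : ℕ) (γ : Set G) :
    arcMapN f P v n γ = μ (pathsWithin f h γ n) := by
  let W : Set (Fin (n + 1) → P) := {w | cylinder f w ∈ refinement f P n ∧ cylinder f w ⊆ γ}
  have hmem (s : ℕ → P) :
      initialWord n s ∈ W ↔ IsPathUpTo (Covers f h) s n ∧ cyl f h s n ⊆ γ := by
    simp only [W, mem_ofPred_eq, cylinder_initialWord hr, hh.cyl_mem_refinement_iff hr]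
  have hword (w : W) : ENNReal.ofReal (weight f P v w.1) = μ (initialWord n ⁻¹' {w.1}) := by
    obtain ⟨w, hw⟩ := w
    obtain ⟨s, rfl⟩ := initialWord_surjective n w
    rw [hμ.measure_word n s ((hmem s).1 hw).1, weight_initialWord hr]
  have hW : initialWord n ⁻¹' W =ᵐ[μ] pathsWithin f h γ n := by
    refine eventuallyEq_set.2 ?_
    filter_upwards [hμ.ae_mem_paths] with s hs
    exact (hmem s).trans
      ⟨fun hsW => mem_sep hs hsW.2, fun hsγ => ⟨isPathUpTo_of_mem_paths hs n, hsγ.2⟩⟩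
  rw [← measure_congr hW, ← tsum_measure_preimage_singleton W.to_countable
    fun w _ => measurable_initialWord n (measurableSet_singleton w)]
  exact tsum_congr hword

theorem arcMap_eq_measure (hh : IsMarkovFamily f h) (hr : ∀ i, range (h i) = i)
    (hμ : IsPathMeasure (Covers f h) v μ) (γ : Set G) :
    arcMap f P v γ = μ (pathsEventuallyWithin f h γ) := by
  rw [arcMap, measure_pathsEventuallyWithin_eq_iSup]
  exact iSup_congr fun n => hh.arcMapN_eq_measure hr hμ n γ

end IsMarkovFamily

end Partitions

end TameGraph

theorem mainTheorem10 {G : Type*} [MetricSpace G] [CompactSpace G] [ConnectedSpace G]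
    (hG : TameGraph.IsTameGraph G)
    (f : G → G) (hf : TameGraph.IsCPM f)
    (P : Set (Set G)) (hP : TameGraph.IsMarkovPartition f P)
    (lam : ℝ) (hlam : 1 < lam)
    (v : P → ℝ) (hv : TameGraph.IsSubeigenvector f P lam v) (hsum : HasSum v 1)
    (hdef : {i : P | TameGraph.rate f P v i < lam}.Finite) :
    -- the arc maps take finite values
    (∀ γ ∈ TameGraph.pointsAndArcs G, TameGraph.arcMap f P v γ < ⊤) ∧
    -- (i) monotone limit
    (∀ γ ∈ TameGraph.pointsAndArcs G,
      (∀ n : ℕ, TameGraph.arcMapN f P v n γ ≤ TameGraph.arcMapN f P v (n + 1) γ) ∧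
      Tendsto (fun n : ℕ => TameGraph.arcMapN f P v n γ) atTop
        (𝓝 (TameGraph.arcMap f P v γ))) ∧
    -- (ii) positivity
    (∀ γ ∈ TameGraph.pointsAndArcs G, (¬ ∃ x, γ = {x}) → 0 < TameGraph.arcMap f P v γ) ∧
    -- (iii) additivity
    (∀ γ ∈ TameGraph.pointsAndArcs G, ∀ t ∈ γ,
      ∀ γ₁ ∈ TameGraph.pointsAndArcs G, ∀ γ₂ ∈ TameGraph.pointsAndArcs G,
        γ = γ₁ ∪ γ₂ → γ₁ ∩ γ₂ = {t} →
        TameGraph.arcMap f P v γ = TameGraph.arcMap f P v γ₁ + TameGraph.arcMap f P v γ₂) ∧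
    -- (iv) continuity along nested sequences shrinking to a point
    (∀ (γ : ℕ → Set G) (x : G), (∀ m, γ m ∈ TameGraph.pointsAndArcs G) →
      (∀ m, γ (m + 1) ⊆ γ m) → (⋂ m, γ m) = {x} →
      Tendsto (fun m : ℕ => TameGraph.arcMap f P v (γ m)) atTop (𝓝 0)) ∧
    -- (v) the infimum over the arcs joining two points is attained
    (∀ x y : G, x ≠ y → ∃ α ∈ TameGraph.arcsBetween x y,
      TameGraph.arcMap f P v α =
        ⨅ β ∈ TameGraph.arcsBetween x y, TameGraph.arcMap f P v β) := by
  obtain ⟨h, hh, hr⟩ := hP.exists_isMarkovFamily hf.continuous hf.mixing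
  have hv' := hv.isNormalizedSubeigenvector hr hlam hsum hdef
  have : Countable P := hP.tame.countable.to_subtype
  have : Nonempty P := hv'.exists_pos.nonempty
  have : Nontrivial P := hh.nontrivial_index
  let _ : MeasurableSpace P := ⊤
  obtain ⟨μ, hμ⟩ := hv'.exists_isPathMeasure hh.isMixingRel_covers
  have := hμ.isProbabilityMeasure
  have := hμ.nullSingletonClass hv' hh.isMixingRel_covers
  have hmono (γ) : Monotone fun n => μ (TameGraph.pathsWithin f h γ n) := fun _ _ hmn =>
    MeasureTheory.measure_mono (TameGraph.monotone_pathsWithin f h γ hmn)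
  simp only [hh.arcMap_eq_measure hr hμ, hh.arcMapN_eq_measure hr hμ]
  refine ⟨fun γ _ => MeasureTheory.measure_lt_top μ _, fun γ _ => ⟨fun n => hmono γ n.le_succ, ?_⟩,
    fun γ hγ hpt => hh.measure_pathsEventuallyWithin_pos hv' hμ
      (hh.interior_nonempty_of_isArc (hγ.resolve_left hpt)), ?_, ?_, fun x y hxy => ?_⟩
  · rw [TameGraph.measure_pathsEventuallyWithin_eq_iSup]
    exact tendsto_atTop_iSup (hmono γ)
  · rintro γ - t - γ₁ h₁ γ₂ h₂ rfl ht
    exact hh.measure_pathsEventuallyWithin_union hμ.ae_mem_paths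
      (TameGraph.isCompact_of_mem_pointsAndArcs h₁).isClosed
      (TameGraph.isCompact_of_mem_pointsAndArcs h₂).isClosed ht
  · exact fun γ x _ hanti hx =>
      hh.tendsto_measure_pathsEventuallyWithin (antitone_nat_of_succ_le hanti) hx.subset
  · obtain ⟨α, hα, hmin⟩ := hh.exists_isArcBetween_measure_le hμ.ae_mem_paths hxy
    exact ⟨α, hα, le_antisymm (le_iInf₂ hmin) (iInf₂_le α hα)⟩
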